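/- Let $\Omega\subset\mathbb R^3$ be a bounded domain (nonempty, open, connected) with boundary of class $C^1$, let $a\in C^0(\partial\Omega,\mathbb R)$ and $a_1,a_2,a_3\in C^1(\overline\Omega,\mathbb R)$. Let $e_1,e_2,e_3$ be the imaginary units of the quaternions $\mathbb H$, and let $T=\sum_{\ell=1}^3 e_\ell a_\ell\partial_{x_\ell}$ act in the sense of distributions on $V=L^2(\Omega,\mathbb H)$, with domain $\operatorname{dom}(T)=\{v\in V: Tv\in V\}$. Let $C_{\partial\Omega}>0$ and $C_P>0$ be constants such that for all $u\in H^1(\Omega,\mathbb R)$ $$\|u\|_{H^{1/2}(\partial\Omega)}\le C_{\partial\Omega}\|u\|_{H^1(\Omega)},\qquad \Big\|u-|\Omega|^{-1}\int_\Omega u\,dx\Big\|_{L^2(\Omega)}\le C_P\|\nabla u\|_{L^2(\Omega)},$$ where $\|g\|_{H^{1/2}(\partial\Omega)}^2=\int_{\partial\Omega}|g|^2dS+\iint_{\partial\Omega\times\partial\Omega}\frac{|g(x)-g(y)|^2}{|x-y|^3}dS(x)\,dS(y)$ (applied to the trace of $u$). Put $$C_T=\min_{\ell}\inf_\Omega a_\ell^2,\qquad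 C_T'=\sum_{i,\ell=1}^3\|a_\ell\partial_{x_\ell}a_i\|_\infty,\qquad K_{a,\Omega}=C_{\partial\Omega}^2\|a\|_\infty ,$$ and assume $C_T-C_T'C_P-K_{a,\Omega}(1+C_P^2)>0$ and $C_T>0$. Let $\mathcal H=\{u\in H^1(\Omega,\mathbb H):\int_\Omega u\,dx=0\}$. For $s\in\mathbb H$ the operator $Q_s(T)=T^2-2\operatorname{Re}(s)T+|s|^2$ with the Robin condition $au+\sum_\ell a_\ell^2n_\ell\partial_{x_\ell}u=0$ on $\partial\Omega$ is understood weakly: for $F\in V$, $Q_s(T)u=F$ means that $u\in\mathcal H$ and for all $v\in\mathcal H$ $$\sum_\ell\int_\Omega \overline{a_\ell\partial_{x_\ell}u}\,a_\ell\partial_{x_\ell}v+\tfrac12\sum_\ell\int_\Omega\overline{\partial_{x_\ell}u}\,\partial_{x_\ell}(a_\ell^2)\,v+\int_\Omega\overline{\operatorname{Vect}(Q_s(T))u}\,v+\int_{\partial\Omega}a\,\overline u\,v\,dS+|s|^2\int_\Omega\overline u\,v=\int_\Omega\overline F\,v ,$$ where $\operatorname{Vect}(Q_s(T))u=\sum_{\ell\ne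 i}e_\ell e_i\,a_\ell(\partial_{x_\ell}a_i)\,\partial_{x_i}u-2\operatorname{Re}(s)\,Tu$. The quaternion $s$ belongs to the $S$-resolvent set $\rho_S(T)$ if this problem has, for every $F\in V$, exactly one solution $u=:Q_s(T)^{-1}F$ and $Q_s(T)^{-1}$ is a bounded right linear operator on $V$; then $$S_L^{-1}(s,T)=Q_s(T)^{-1}\overline s-TQ_s(T)^{-1},\qquad S_R^{-1}(s,T)=-(T-\overline s)Q_s(T)^{-1}.$$ Then every $s\in\mathbb H\setminus\{0\}$ with $\operatorname{Re}(s)=0$ belongs to $\rho_S(T)$, and $Q_s(T)^{-1}$ maps $V$ into $\operatorname{dom}(T)$. Moreover, for every $I\in\mathbb H$ with $\operatorname{Re}(I)=0$ and $|I|=1$, every $\alpha\in(0,1)$ and every $v\in\operatorname{dom}(T)$, the integrals $$\frac1{2\pi}\int_{-I\mathbb R}S_L^{-1}(s,T)\,ds_I\,s^{\alpha-1}Tv,\qquad \frac1{2\pi}\int_{-I\mathbb R}s^{\alpha-1}\,ds_I\,S_R^{-1}(s,T)Tv,\qquad ds_I=ds/I,$$ converge absolutely in $L^2(\Omega,\mathbb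 H)$. -/

import Mathlib

open MeasureTheory Filter Topology
open scoped ENNReal Quaternion

noncomputable section

namespace RobinFractional

/-- Euclidean three-space. -/
abbrev E3 : Type := EuclideanSpace ℝ (Fin 3)

/-- The partial derivative `∂_{x_i} f (x)`. -/
def pd {F : Type*} [NormedAddCommGroup F] [NormedSpace ℝ F] (i : Fin 3) (f : E3 → F) (x : E3) : F :=
  fderiv ℝ f x (EuclideanSpace.single i 1)

/-! ### The domain and the coefficients -/

/-- A bounded domain (nonempty, open, connected set) of `ℝ³` with boundary of class `C¹`: near each
boundary point, in suitable orthonormal coordinates, it is the region above the graph of a `C¹`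
function of two variables. -/
structure IsBoundedC1Domain (Ω : Set E3) : Prop where
  isOpen : IsOpen Ω
  isConnected : IsConnected Ω
  isBounded : Bornology.IsBounded Ω
  boundary : ∀ p ∈ frontier Ω, ∃ r > 0, ∃ L : E3 ≃ₗᵢ[ℝ] E3, ∃ γ : ℝ × ℝ → ℝ,
    ContDiff ℝ 1 γ ∧ ∀ x ∈ Metric.ball p r, x ∈ Ω ↔ γ (L x 0, L x 1) < L x 2

/-- `f ∈ C¹(Ω̄, ℝ)`: `f` is continuous on the closure, `C¹` in `Ω`, and its derivative extends
continuously to the closure. -/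
structure IsC1Closure (Ω : Set E3) (f : E3 → ℝ) : Prop where
  continuousOn : ContinuousOn f (closure Ω)
  contDiffOn : ContDiffOn ℝ 1 f Ω
  extends_deriv : ∃ G : E3 → E3 →L[ℝ] ℝ, ContinuousOn G (closure Ω) ∧ ∀ x ∈ Ω, fderiv ℝ f x = G x

/-- Lebesgue measure on `Ω`. -/
abbrev vol (Ω : Set E3) : Measure E3 := volume.restrict Ω

/-- Surface measure on `∂Ω`: the two-dimensional Hausdorff measure, normalised so that it agrees
with Lebesgue measure on planes. -/
abbrev surf (Ω : Set E3) : Measure E3 := (μHE[2] : Measure E3).restrict (frontier Ω)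

/-! ### Sobolev space, trace, norms -/

section Sobolev

variable {F : Type*} [NormedAddCommGroup F] [NormedSpace ℝ F]

/-- `φ` is a real test function: `C¹` with compact support contained in `Ω`. -/
structure IsTest (Ω : Set E3) (φ : E3 → ℝ) : Prop where
  contDiff : ContDiff ℝ 1 φ
  hasCompactSupport : HasCompactSupport φ
  tsupport_subset : tsupport φ ⊆ Ω

/-- `u ∈ H¹(Ω, F)` with weak gradient `Du = (∂₁u, ∂₂u, ∂₃u)`. -/
structure IsH1 (Ω : Set E3) (u : E3 → F) (Du : Fin 3 → E3 → F) : Prop where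
  memLp : MemLp u 2 (vol Ω)
  memLp_deriv : ∀ i, MemLp (Du i) 2 (vol Ω)
  weak_deriv : ∀ i φ, IsTest Ω φ → ∫ x in Ω, φ x • Du i x = - ∫ x in Ω, pd i φ x • u x

/-- `g ∈ L²(∂Ω, F)` is the boundary trace of the `H¹(Ω, F)` function `u` (with weak gradient `Du`):
the limit in `L²(∂Ω)` of the boundary values of functions that are `C¹` up to the boundary and
converge to `u` in `H¹(Ω)`. On a bounded `C¹` domain every `H¹` function has exactly one trace. -/
def IsTrace (Ω : Set E3) (u : E3 → F) (Du : Fin 3 → E3 → F) (g : E3 → F) : Prop :=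
  MemLp g 2 (surf Ω) ∧
  ∃ U : ℕ → E3 → F, (∀ n, ContDiff ℝ 1 (U n)) ∧
    Tendsto (fun n => eLpNorm (fun x => U n x - u x) 2 (vol Ω)) atTop (𝓝 0) ∧
    (∀ i, Tendsto (fun n => eLpNorm (fun x => pd i (U n) x - Du i x) 2 (vol Ω)) atTop (𝓝 0)) ∧
    Tendsto (fun n => eLpNorm (fun x => U n x - g x) 2 (surf Ω)) atTop (𝓝 0)

/-- `‖∇u‖_{L²(Ω)}`. -/
def gradNorm (Ω : Set E3) (Du : Fin 3 → E3 → F) : ℝ≥0∞ :=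
  (∑ i, eLpNorm (Du i) 2 (vol Ω) ^ 2) ^ (1 / 2 : ℝ)

/-- `‖u‖_{H¹(Ω)}`. -/
def h1Norm (Ω : Set E3) (u : E3 → F) (Du : Fin 3 → E3 → F) : ℝ≥0∞ :=
  (eLpNorm u 2 (vol Ω) ^ 2 + ∑ i, eLpNorm (Du i) 2 (vol Ω) ^ 2) ^ (1 / 2 : ℝ)

/-- The Sobolev–Slobodeckij norm of `H^{1/2}(∂Ω)`, where `∂Ω` is two-dimensional:
`‖g‖² = ∫ |g|² dS + ∬ |g(x) - g(y)|² / |x - y|³ dS dS`. -/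
def hHalfNorm (Ω : Set E3) (g : E3 → F) : ℝ≥0∞ :=
  ((∫⁻ x, ‖g x‖ₑ ^ 2 ∂(surf Ω)) +
    ∫⁻ x, ∫⁻ y, ‖g x - g y‖ₑ ^ 2 / edist x y ^ 3 ∂(surf Ω) ∂(surf Ω)) ^ (1 / 2 : ℝ)

end Sobolev

/-- `C` is a constant of the trace inequality `‖u‖_{H^{1/2}(∂Ω)} ≤ C ‖u‖_{H¹(Ω)}`,
`u ∈ H¹(Ω, ℝ)`. -/
def IsTraceConstant (Ω : Set E3) (C : ℝ) : Prop :=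
  0 < C ∧ ∀ (u : E3 → ℝ) (Du : Fin 3 → E3 → ℝ) (g : E3 → ℝ), IsH1 Ω u Du → IsTrace Ω u Du g →
    hHalfNorm Ω g ≤ ENNReal.ofReal C * h1Norm Ω u Du

/-- `C` is a constant of the Poincaré–Wirtinger inequality
`‖u - |Ω|⁻¹ ∫ u‖_{L²(Ω)} ≤ C ‖∇u‖_{L²(Ω)}`, `u ∈ H¹(Ω, ℝ)`. -/
def IsPoincareWirtingerConstant (Ω : Set E3) (C : ℝ) : Prop :=
  0 < C ∧ ∀ (u : E3 → ℝ) (Du : Fin 3 → E3 → ℝ), IsH1 Ω u Du →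
    eLpNorm (fun x => u x - ⨍ y in Ω, u y) 2 (vol Ω) ≤ ENNReal.ofReal C * gradNorm Ω Du

/-! ### The constants of the coefficients -/

/-- `C_T = min_ℓ inf_Ω a_ℓ²`. -/
def constT (Ω : Set E3) (a : Fin 3 → E3 → ℝ) : ℝ := ⨅ l : Fin 3, ⨅ x : Ω, a l x ^ 2

/-- `C'_T = ∑_{i,ℓ} ‖a_ℓ ∂_{x_ℓ} a_i‖_∞`. -/
def constT' (Ω : Set E3) (a : Fin 3 → E3 → ℝ) : ℝ :=
  ∑ i : Fin 3, ∑ l : Fin 3, ⨆ x : Ω, |a l x * pd l (a i) x|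

/-- `K_{a,Ω} = C_{∂Ω}² ‖a‖_∞`, with `b` in the role of the boundary coefficient. -/
def constK (Ω : Set E3) (b : E3 → ℝ) (Ctr : ℝ) : ℝ := Ctr ^ 2 * ⨆ x : frontier Ω, |b x|

/-! ### Quaternions -/

/-- The imaginary units `e₁, e₂, e₃` of the quaternions. -/
def e : Fin 3 → ℍ[ℝ] := ![⟨0, 1, 0, 0⟩, ⟨0, 0, 1, 0⟩, ⟨0, 0, 0, 1⟩]

/-- The power `s^β = |s|^β (cos βθ + J sin βθ)` of a quaternion `s = |s| (cos θ + J sin θ)`,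
`J = Im s / |Im s|`, `θ = arccos (Re s / |s|)`, off the half line `(-∞, 0]`. -/
def qpow (s : ℍ[ℝ]) (β : ℝ) : ℍ[ℝ] :=
  (‖s‖ ^ β) • (((Real.cos (β * Real.arccos (s.re / ‖s‖)) : ℝ) : ℍ[ℝ]) +
    (Real.sin (β * Real.arccos (s.re / ‖s‖)) / ‖s.im‖) • s.im)

/-- The two-sided quaternionic Hilbert space `L²(Ω, ℍ)`. -/
abbrev V (Ω : Set E3) : Type := Lp ℍ[ℝ] 2 (vol Ω)

/-! ### The operator `T = ∑ e_ℓ a_ℓ ∂_{x_ℓ}` -/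

/-- `w = T v` in the sense of distributions on `Ω`, for `v, w ∈ L²(Ω, ℍ)`. -/
def IsVecOp (Ω : Set E3) (a : Fin 3 → E3 → ℝ) (v w : V Ω) : Prop :=
  ∀ φ, IsTest Ω φ → ∫ x in Ω, φ x • w x =
    - ∑ l, ∫ x in Ω, pd l (fun y => a l y * φ y) x • (e l * v x)

/-- The domain of `T` as a closed operator in `L²(Ω, ℍ)`: all `v ∈ L²` with `T v ∈ L²`. -/
def domT (Ω : Set E3) (a : Fin 3 → E3 → ℝ) : Set (V Ω) := {v | ∃ w, IsVecOp Ω a v w}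

open Classical in
/-- `T v` for `v ∈ dom(T)` (and `0` for other `v`). -/
def opT (Ω : Set E3) (a : Fin 3 → E3 → ℝ) (v : V Ω) : V Ω :=
  if h : ∃ w, IsVecOp Ω a v w then h.choose else 0

/-! ### The operator `Q_s(T) = T² - 2 Re(s) T + |s|²` with the Robin condition -/

/-- The vector part of `Q_s(T)` applied to `u` with weak gradient `Du`. In the vector part
`∑_{ℓ ≠ i} e_ℓ e_i a_ℓ ∂_ℓ (a_i ∂_i u)` of `T² u` the second order terms cancel. -/
def vectQ (a : Fin 3 → E3 → ℝ) (s : ℍ[ℝ]) (Du : Fin 3 → E3 → ℍ[ℝ]) (x : E3) : ℍ[ℝ] :=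
  (∑ l, ∑ i, if l = i then 0 else (a l x * pd l (a i) x) • (e l * e i * Du i x))
    - (2 * s.re) • ∑ l, a l x • (e l * Du l x)

/-- The sesquilinear form of `Q_s(T)` with the boundary condition
`b u + ∑ a_ℓ² n_ℓ ∂_ℓ u = 0` on `∂Ω`; `g` and `h` are the traces of `u` and `v`. -/
def formQ (Ω : Set E3) (a : Fin 3 → E3 → ℝ) (b : E3 → ℝ) (s : ℍ[ℝ])
    (u : E3 → ℍ[ℝ]) (Du : Fin 3 → E3 → ℍ[ℝ]) (g : E3 → ℍ[ℝ])
    (v : E3 → ℍ[ℝ]) (Dv : Fin 3 → E3 → ℍ[ℝ]) (h : E3 → ℍ[ℝ]) : ℍ[ℝ] :=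
  (∑ l, ∫ x in Ω, star (a l x • Du l x) * (a l x • Dv l x))
    + (1 / 2 : ℝ) • (∑ l, ∫ x in Ω, star (Du l x) * (pd l (fun y => a l y ^ 2) x • v x))
    + (∫ x in Ω, star (vectQ a s Du x) * v x)
    + (∫ x, b x • (star (g x) * h x) ∂(surf Ω))
    + (‖s‖ ^ 2) • ∫ x in Ω, star (u x) * v x

/-- `(u, Du, g)` is an element of `𝓗 = {u ∈ H¹(Ω, ℍ) | ∫_Ω u = 0}` with its weak gradient and
its trace. -/
structure IsMeanZeroH1 (Ω : Set E3) (u : E3 → ℍ[ℝ]) (Du : Fin 3 → E3 → ℍ[ℝ]) (g : E3 → ℍ[ℝ]) :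
    Prop where
  isH1 : IsH1 Ω u Du
  isTrace : IsTrace Ω u Du g
  mean_zero : ∫ x in Ω, u x = 0

/-- `u` is a weak solution in `𝓗` of `Q_s(T) u = F` with the Robin boundary condition. -/
def IsWeakSol (Ω : Set E3) (a : Fin 3 → E3 → ℝ) (b : E3 → ℝ) (s : ℍ[ℝ]) (F u : V Ω) : Prop :=
  ∃ Du g, IsMeanZeroH1 Ω u Du g ∧ ∀ v Dv h, IsMeanZeroH1 Ω v Dv h →
    formQ Ω a b s u Du g v Dv h = ∫ x in Ω, star (F x) * v x

/-- The bounded right linear operator `R` is the inverse of `Q_s(T)`: for each `F`, `R F` is the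
unique weak solution of `Q_s(T) u = F`. -/
def IsInverseQ (Ω : Set E3) (a : Fin 3 → E3 → ℝ) (b : E3 → ℝ) (s : ℍ[ℝ])
    (R : V Ω →L[ℍ[ℝ]ᵐᵒᵖ] V Ω) : Prop :=
  ∀ F u, IsWeakSol Ω a b s F u ↔ u = R F

/-- The `S`-resolvent set. -/
def sResolventSet (Ω : Set E3) (a : Fin 3 → E3 → ℝ) (b : E3 → ℝ) : Set ℍ[ℝ] :=
  {s | ∃ R, IsInverseQ Ω a b s R}

open Classical in
/-- The pseudo `S`-resolvent operator `Q_s(T)⁻¹` (and `0` off the `S`-resolvent set). -/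
def pseudoRes (Ω : Set E3) (a : Fin 3 → E3 → ℝ) (b : E3 → ℝ) (s : ℍ[ℝ]) :
    V Ω →L[ℍ[ℝ]ᵐᵒᵖ] V Ω :=
  if h : ∃ R, IsInverseQ Ω a b s R then h.choose else 0

/-- The left `S`-resolvent operator `Q_s(T)⁻¹ s̄ - T Q_s(T)⁻¹`. -/
def leftSRes (Ω : Set E3) (a : Fin 3 → E3 → ℝ) (b : E3 → ℝ) (s : ℍ[ℝ]) (F : V Ω) : V Ω :=
  pseudoRes Ω a b s (star s • F) - opT Ω a (pseudoRes Ω a b s F)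

/-- The right `S`-resolvent operator `-(T - s̄) Q_s(T)⁻¹`. -/
def rightSRes (Ω : Set E3) (a : Fin 3 → E3 → ℝ) (b : E3 → ℝ) (s : ℍ[ℝ]) (F : V Ω) : V Ω :=
  -(opT Ω a (pseudoRes Ω a b s F) - star s • pseudoRes Ω a b s F)

/-! ### The integrands of the fractional powers -/

/-- The integrand of `(2π)⁻¹ ∫_{-Iℝ} S_L⁻¹(s,T) ds_I s^{α-1} T v`, `ds_I = ds / I`, under the
parametrisation `s = -I t`, `ds = -I dt`. -/
def integrandL (Ω : Set E3) (a : Fin 3 → E3 → ℝ) (b : E3 → ℝ) (I : ℍ[ℝ]) (α : ℝ) (v : V Ω)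
    (t : ℝ) : V Ω :=
  (2 * Real.pi)⁻¹ •
    leftSRes Ω a b (-(t • I)) (((-I) * I⁻¹ * qpow (-(t • I)) (α - 1)) • opT Ω a v)

/-- The integrand of `(2π)⁻¹ ∫_{-Iℝ} s^{α-1} ds_I S_R⁻¹(s,T) T v`, under the same
parametrisation. -/
def integrandR (Ω : Set E3) (a : Fin 3 → E3 → ℝ) (b : E3 → ℝ) (I : ℍ[ℝ]) (α : ℝ) (v : V Ω)
    (t : ℝ) : V Ω :=
  (2 * Real.pi)⁻¹ •
    ((qpow (-(t • I)) (α - 1) * ((-I) * I⁻¹)) • rightSRes Ω a b (-(t • I)) (opT Ω a v))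

end RobinFractional

end

/-! On mean zero functions the Poincaré–Wirtinger and trace inequalities turn the smallness
condition into coercivity of the real part of the form of `T²` with the Robin condition. The closure
of the `C¹` functions, taken with their gradients and boundary values, is complete, so the
Lax–Milgram theorem applies. For `Re s = 0` the parameter only adds `|s|² ‖u‖²`, which keeps
the coercivity constant, and since `𝓗` is stable under right multiplication by quaternions, the real
variational equation already gives the quaternionic one and the solution operator is right linear.

Testing the equation with the solution gives `δ ‖u‖²_{H¹} + |s|² ‖u‖² ≤ ‖F‖ ‖u‖`. Hence
`‖S_L⁻¹(s, T)‖` and `‖S_R⁻¹(s, T)‖` are at most `Θ / (1 + |s|)`, and the integrands of the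
fractional powers are bounded by a multiple of `|t|^(α - 1) / (1 + |t|)`, which is integrable for
`0 < α < 1`. -/

noncomputable section

namespace RobinFractional

/-! ### Variational problems with a spectral parameter -/

section Variational

variable {X Y : Type*} [NormedAddCommGroup X] [InnerProductSpace ℝ X]
  [NormedAddCommGroup Y] [InnerProductSpace ℝ Y] {B : X →L[ℝ] X →L[ℝ] ℝ}

/-- The form `B + t² ⟪P ·, P ·⟫` on `X`, for a spectral parameter `t`. -/
def shiftedForm (B : X →L[ℝ] X →L[ℝ] ℝ) (P : X →L[ℝ] Y) (t : ℝ) : X →L[ℝ] X →L[ℝ] ℝ :=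
  B + t ^ 2 • (isBoundedBilinearMap_inner (𝕜 := ℝ)).toContinuousLinearMap.bilinearComp P P

theorem shiftedForm_apply (B : X →L[ℝ] X →L[ℝ] ℝ) (P : X →L[ℝ] Y) (t : ℝ) (x y : X) :
    shiftedForm B P t x y = B x y + t ^ 2 * inner ℝ (P x) (P y) :=
  rfl

theorem isCoercive_shiftedForm (hB : IsCoercive B) (P : X →L[ℝ] Y) (t : ℝ) :
    IsCoercive (shiftedForm B P t) := by
  obtain ⟨δ, hδ, h⟩ := hB
  refine ⟨δ, hδ, fun x => (h x).trans ?_⟩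
  rw [shiftedForm_apply, real_inner_self_eq_norm_sq]
  exact le_add_of_nonneg_right (by positivity)

variable [CompleteSpace X] [CompleteSpace Y]

/-- The solution operator `F ↦ x` of the variational problem
`B x y + t² ⟪P x, P y⟫ = ⟪F, P y⟫` for all `y`, given by the Lax–Milgram theorem. -/
def varSolver (hB : IsCoercive B) (P : X →L[ℝ] Y) (t : ℝ) : Y →L[ℝ] X :=
  ((isCoercive_shiftedForm hB P t).continuousLinearEquivOfBilin.symm : X →L[ℝ] X) ∘L
    ContinuousLinearMap.adjoint P

theorem eq_varSolver_iff (hB : IsCoercive B) {P : X →L[ℝ] Y} {t : ℝ} {F : Y} {x : X} :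
    x = varSolver hB P t F ↔ ∀ y, shiftedForm B P t x y = inner ℝ F (P y) := by
  have hcoer := isCoercive_shiftedForm hB P t
  have hx : x = varSolver hB P t F ↔
      hcoer.continuousLinearEquivOfBilin x = ContinuousLinearMap.adjoint P F :=
    ContinuousLinearEquiv.eq_symm_apply _
  rw [hx]
  refine ⟨fun h y => ?_, fun h => ?_⟩
  · rw [← hcoer.continuousLinearEquivOfBilin_apply, h, ContinuousLinearMap.adjoint_inner_left]
  · refine (hcoer.unique_continuousLinearEquivOfBilin fun y => ?_).symm
    rw [ContinuousLinearMap.adjoint_inner_left, h]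

theorem shiftedForm_varSolver (hB : IsCoercive B) (P : X →L[ℝ] Y) (t : ℝ) (F : Y) (y : X) :
    shiftedForm B P t (varSolver hB P t F) y = inner ℝ F (P y) :=
  (eq_varSolver_iff hB).1 rfl y

theorem continuous_varSolver (hB : IsCoercive B) (P : X →L[ℝ] Y) :
    Continuous (varSolver hB P) := by
  let A (t : ℝ) : X →L[ℝ] X := hB.continuousLinearEquivOfBilin +
    t ^ 2 • (ContinuousLinearMap.adjoint P ∘L P)
  have hA (t : ℝ) : ((isCoercive_shiftedForm hB P t).continuousLinearEquivOfBilin : X →L[ℝ] X) =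
      A t := by
    refine ContinuousLinearMap.ext fun x => ext_inner_right ℝ fun y => ?_
    simp [A, shiftedForm_apply, inner_add_left, real_inner_smul_left,
      ContinuousLinearMap.adjoint_inner_left]
  have hinv (t : ℝ) : varSolver hB P t = (A t).inverse ∘L ContinuousLinearMap.adjoint P := by
    rw [← hA, ContinuousLinearMap.inverse_equiv, varSolver]
  simp_rw [continuous_iff_continuousAt, funext hinv]
  intro t
  have hcont : ContinuousAt ContinuousLinearMap.inverse (A t) := by
    rw [← hA]
    exact (contDiffAt_map_inverse (n := 0) _).continuousAt
  have hAcont : Continuous A := by fun_prop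
  exact (ContinuousAt.comp hcont hAcont.continuousAt).clm_comp continuousAt_const

section Decay

variable {δ : ℝ} (hB : IsCoercive B) (P : X →L[ℝ] Y) (t : ℝ) (F : Y)

theorem energy_varSolver_le (hBδ : ∀ x, δ * ‖x‖ * ‖x‖ ≤ B x x) :
    δ * ‖varSolver hB P t F‖ ^ 2 + t ^ 2 * ‖P (varSolver hB P t F)‖ ^ 2 ≤
      ‖F‖ * ‖P (varSolver hB P t F)‖ := by
  set x := varSolver hB P t F
  calc δ * ‖x‖ ^ 2 + t ^ 2 * ‖P x‖ ^ 2 ≤ shiftedForm B P t x x := by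
        rw [shiftedForm_apply, real_inner_self_eq_norm_sq, sq ‖x‖, ← mul_assoc]
        gcongr
        exact hBδ x
    _ = inner ℝ F (P x) := shiftedForm_varSolver hB P t F x
    _ ≤ ‖F‖ * ‖P x‖ := real_inner_le_norm _ _

variable (hδ : 0 < δ) (hBδ : ∀ x, δ * ‖x‖ * ‖x‖ ≤ B x x)
include hδ hBδ

theorem sq_mul_norm_varSolver_le : t ^ 2 * ‖P (varSolver hB P t F)‖ ≤ ‖F‖ := by
  have h := energy_varSolver_le hB P t F hBδ
  rcases (norm_nonneg (P (varSolver hB P t F))).eq_or_lt with h0 | h0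
  · simp [← h0]
  · have : 0 ≤ δ * ‖varSolver hB P t F‖ ^ 2 := by positivity
    exact le_of_mul_le_mul_right (by linarith) h0

theorem norm_varSolver_le : ‖varSolver hB P t F‖ ≤ δ⁻¹ * ‖P‖ * ‖F‖ := by
  set x := varSolver hB P t F
  rw [mul_assoc, inv_mul_eq_div, le_div_iff₀' hδ]
  rcases (norm_nonneg x).eq_or_lt with h0 | h0
  · rw [← h0, mul_zero]
    positivity
  · refine le_of_mul_le_mul_right ?_ h0
    calc δ * ‖x‖ * ‖x‖ ≤ δ * ‖x‖ ^ 2 + t ^ 2 * ‖P x‖ ^ 2 := by nlinarith [sq_nonneg (t * ‖P x‖)]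
      _ ≤ ‖F‖ * ‖P x‖ := energy_varSolver_le hB P t F hBδ
      _ ≤ ‖F‖ * (‖P‖ * ‖x‖) := by gcongr; exact P.le_opNorm x
      _ = ‖P‖ * ‖F‖ * ‖x‖ := by ring

theorem abs_mul_norm_varSolver_le : |t| * ‖varSolver hB P t F‖ ≤ (√δ)⁻¹ * ‖F‖ := by
  set x := varSolver hB P t F
  rw [inv_mul_eq_div, le_div_iff₀ (Real.sqrt_pos.2 hδ)]
  refine le_of_sq_le_sq ?_ (norm_nonneg F)
  calc (|t| * ‖x‖ * √δ) ^ 2 = t ^ 2 * (δ * ‖x‖ ^ 2) := by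
        rw [mul_pow, mul_pow, Real.sq_sqrt hδ.le, sq_abs]
        ring
    _ ≤ t ^ 2 * (‖F‖ * ‖P x‖) := by
        gcongr t ^ 2 * ?_
        exact (le_add_of_nonneg_right (by positivity)).trans (energy_varSolver_le hB P t F hBδ)
    _ = ‖F‖ * (t ^ 2 * ‖P x‖) := by ring
    _ ≤ ‖F‖ * ‖F‖ := by gcongr; exact sq_mul_norm_varSolver_le hB P t F hδ hBδ
    _ = ‖F‖ ^ 2 := (sq _).symm

theorem one_add_abs_mul_norm_varSolver_le :
    (1 + |t|) * ‖varSolver hB P t F‖ ≤ (δ⁻¹ * ‖P‖ + (√δ)⁻¹) * ‖F‖ := by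
  linarith [norm_varSolver_le hB P t F hδ hBδ, abs_mul_norm_varSolver_le hB P t F hδ hBδ]

theorem abs_mul_one_add_abs_mul_norm_le :
    |t| * (1 + |t|) * ‖P (varSolver hB P t F)‖ ≤ (‖P‖ * (√δ)⁻¹ + 1) * ‖F‖ := by
  set x := varSolver hB P t F
  calc |t| * (1 + |t|) * ‖P x‖ = |t| * ‖P x‖ + t ^ 2 * ‖P x‖ := by rw [← sq_abs t]; ring
    _ ≤ |t| * (‖P‖ * ‖x‖) + ‖F‖ := by
        gcongr
        · exact P.le_opNorm x
        · exact sq_mul_norm_varSolver_le hB P t F hδ hBδ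
    _ = ‖P‖ * (|t| * ‖x‖) + ‖F‖ := by ring
    _ ≤ ‖P‖ * ((√δ)⁻¹ * ‖F‖) + ‖F‖ := by
        gcongr ‖P‖ * ?_ + ‖F‖
        exact abs_mul_norm_varSolver_le hB P t F hδ hBδ
    _ = (‖P‖ * (√δ)⁻¹ + 1) * ‖F‖ := by ring

end Decay

end Variational

/-! ### Powers along the imaginary axis -/

section PowerIntegrals

variable {α : ℝ}

theorem integrable_abs_rpow_div_one_add_abs (hα : 0 < α) (hα1 : α < 1) :
    Integrable fun t : ℝ => |t| ^ (α - 1) / (1 + |t|) := by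
  set f : ℝ → ℝ := fun t => |t| ^ (α - 1) / (1 + |t|)
  have hmeas : AEStronglyMeasurable f :=
    (show Measurable f by fun_prop).aestronglyMeasurable
  have hnorm (t : ℝ) : ‖f t‖ = f t := Real.norm_of_nonneg (by positivity)
  have hzero : IntegrableOn f (Set.Ioc 0 1) := by
    refine Integrable.mono' ((intervalIntegrable_iff_integrableOn_Ioc_of_le zero_le_one).1
      (intervalIntegral.intervalIntegrable_rpow' (r := α - 1) (by linarith))) hmeas.restrict ?_
    filter_upwards [ae_restrict_mem measurableSet_Ioc] with t ht
    rw [hnorm]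
    simp only [f, abs_of_pos ht.1]
    exact div_le_self (Real.rpow_nonneg ht.1.le _) (by linarith [ht.1])
  have hinfty : IntegrableOn f (Set.Ioi 1) := by
    refine Integrable.mono' (integrableOn_Ioi_rpow_of_lt (a := α - 1 - 1) (by linarith) one_pos)
      hmeas.restrict ?_
    filter_upwards [ae_restrict_mem measurableSet_Ioi] with t ht
    have ht0 : 0 < t := one_pos.trans ht
    rw [hnorm]
    simp only [f, abs_of_pos ht0]
    rw [Real.rpow_sub_one ht0.ne' (α - 1)]
    exact div_le_div_of_nonneg_left (Real.rpow_nonneg ht0.le _) ht0 (by linarith)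
  have hpos : IntegrableOn f (Set.Ioi 0) := by
    simpa [Set.Ioc_union_Ioi_eq_Ioi zero_le_one] using hzero.union hinfty
  have hneg : IntegrableOn f (Set.Iic 0) := by
    simpa [f] using ((integrableOn_Ici_iff_integrableOn_Ioi).2 hpos).comp_neg
  simpa [Set.Iic_union_Ioi] using hneg.union hpos

theorem integrable_of_norm_le_abs_rpow_div {Y : Type*} [NormedAddCommGroup Y] {f : ℝ → Y} {M : ℝ}
    (hα : 0 < α) (hα1 : α < 1) (hf : ContinuousOn f {0}ᶜ)
    (hM : ∀ t, t ≠ 0 → ‖f t‖ ≤ M * (|t| ^ (α - 1) / (1 + |t|))) : Integrable f := by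
  have hmeas : AEStronglyMeasurable f := by
    simpa using hf.aestronglyMeasurable (μ := volume) (measurableSet_singleton 0).compl
  refine Integrable.mono' ((integrable_abs_rpow_div_one_add_abs hα hα1).const_mul M) hmeas ?_
  filter_upwards [compl_mem_ae_iff.2 (measure_singleton (0 : ℝ))] with t ht using hM t ht

end PowerIntegrals

section ImaginaryAxis

theorem norm_qpow_le (s : ℍ[ℝ]) (β : ℝ) : ‖qpow s β‖ ≤ 2 * ‖s‖ ^ β := by
  set φ := β * Real.arccos (s.re / ‖s‖)
  have hcos : ‖((Real.cos φ : ℝ) : ℍ[ℝ])‖ ≤ 1 := by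
    rw [Quaternion.norm_coe]
    exact Real.abs_cos_le_one φ
  have hsin : ‖(Real.sin φ / ‖s.im‖) • s.im‖ ≤ 1 := by
    rw [norm_smul, norm_div, norm_norm, Real.norm_eq_abs, div_mul_eq_mul_div, mul_div_assoc]
    exact mul_le_one₀ (Real.abs_sin_le_one φ) (by positivity) (div_self_le_one _)
  rw [qpow, norm_smul, Real.norm_of_nonneg (by positivity), mul_comm]
  gcongr
  linarith [norm_add_le_of_le hcos hsin]

variable {I : ℍ[ℝ]}

theorem norm_neg_smul_unit (hI1 : ‖I‖ = 1) (t : ℝ) : ‖-(t • I)‖ = |t| := by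
  rw [norm_neg, norm_smul, hI1, mul_one, Real.norm_eq_abs]

theorem continuousOn_qpow_neg_smul (hI : I.re = 0) (hI1 : ‖I‖ = 1) (β : ℝ) :
    ContinuousOn (fun t : ℝ => qpow (-(t • I)) β) {0}ᶜ := by
  have hre (t : ℝ) : (-(t • I)).re = 0 := by simp [hI]
  have him (t : ℝ) : (-(t • I)).im = -(t • I) := by ext <;> simp [hI]
  have habs : ContinuousOn (fun t : ℝ => |t|) {0}ᶜ := continuous_abs.continuousOn
  have hne : ∀ t ∈ ({0}ᶜ : Set ℝ), |t| ≠ 0 := fun t ht => abs_ne_zero.2 ht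
  simp only [qpow, hre, him, norm_neg_smul_unit hI1, zero_div]
  exact (habs.rpow_const fun t ht => Or.inl (hne t ht)).smul
    (continuousOn_const.add ((continuousOn_const.div habs hne).smul (by fun_prop)))

end ImaginaryAxis

/-! ### Multiplication and pairing on `L²` -/

section Multiplication

variable {α : Type*} [MeasurableSpace α] {μ : Measure α} {m : α → ℝ} (hm : MemLp m ∞ μ)

/-- Multiplication by the essentially bounded real function `m` on `L²(μ, F)`. -/
def mulReal {F : Type*} [NormedAddCommGroup F] [NormedSpace ℝ F] : Lp F 2 μ →L[ℝ] Lp F 2 μ :=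
  (ContinuousLinearMap.lsmul ℝ ℝ).holderL μ ∞ 2 2 (hm.toLp m)

theorem coeFn_mulReal {F : Type*} [NormedAddCommGroup F] [NormedSpace ℝ F] (f : Lp F 2 μ) :
    mulReal hm f =ᵐ[μ] fun x => m x • f x := by
  filter_upwards [(ContinuousLinearMap.lsmul ℝ ℝ).coeFn_holder (r := 2) (hm.toLp m) f,
    hm.coeFn_toLp] with x h h'
  exact h.trans (by simp [h'])

theorem norm_mulReal_le {F : Type*} [NormedAddCommGroup F] [NormedSpace ℝ F] {C : ℝ}
    (hC : ∀ᵐ x ∂μ, |m x| ≤ C) (f : Lp F 2 μ) : ‖mulReal hm f‖ ≤ C * ‖f‖ := by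
  refine Lp.norm_le_mul_norm_of_ae_le_mul ?_
  filter_upwards [hC, coeFn_mulReal hm f] with x hx hx'
  rw [hx', norm_smul, Real.norm_eq_abs]
  gcongr

theorem mul_norm_sq_le_norm_mulReal_sq {F : Type*} [NormedAddCommGroup F] [InnerProductSpace ℝ F]
    {C : ℝ} (hC : ∀ᵐ x ∂μ, C ≤ m x ^ 2) (f : Lp F 2 μ) : C * ‖f‖ ^ 2 ≤ ‖mulReal hm f‖ ^ 2 := by
  simp_rw [← real_inner_self_eq_norm_sq, L2.inner_def, ← integral_const_mul]
  refine integral_mono_ae ((L2.integrable_inner f f).const_mul C) (L2.integrable_inner _ _) ?_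
  filter_upwards [hC, coeFn_mulReal hm f] with x hx hx'
  simp_rw [hx', real_inner_self_eq_norm_sq, norm_smul, mul_pow, Real.norm_eq_abs, sq_abs]
  gcongr

end Multiplication

section Pairing

variable {α : Type*} [MeasurableSpace α] {μ : Measure α}

theorem coeFn_op_smul (c : ℍ[ℝ]) (f : Lp ℍ[ℝ] 2 μ) :
    (MulOpposite.op c • f : Lp ℍ[ℝ] 2 μ) =ᵐ[μ] fun x => f x * c :=
  Lp.coeFn_smul (MulOpposite.op c) f

theorem mulReal_op_smul {m : α → ℝ} (hm : MemLp m ∞ μ) (c : ℍ[ℝ]) (f : Lp ℍ[ℝ] 2 μ) :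
    mulReal hm (MulOpposite.op c • f) = MulOpposite.op c • mulReal hm f := by
  refine Lp.ext ?_
  filter_upwards [coeFn_mulReal hm f, coeFn_mulReal hm (MulOpposite.op c • f), coeFn_op_smul c f,
    coeFn_op_smul c (mulReal hm f)] with x h1 h2 h3 h4
  rw [h2, h3, h4, h1, smul_mul_assoc]

/-- Quaternionic conjugation as a real linear map. -/
def starCLM : ℍ[ℝ] →L[ℝ] ℍ[ℝ] :=
  LinearMap.mkContinuous
    { toFun := star
      map_add' := star_add
      map_smul' := fun r q => by simp [Quaternion.star_smul] } 1 fun q => by simp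

/-- The quaternionic inner product `∫ p̄ q` of `L²(μ, ℍ)`. -/
def qpair (μ : Measure α) : Lp ℍ[ℝ] 2 μ →L[ℝ] Lp ℍ[ℝ] 2 μ →L[ℝ] ℍ[ℝ] :=
  (ContinuousLinearMap.mul ℝ ℍ[ℝ] ∘L starCLM).lpPairing μ 2 2

theorem qpair_apply (p q : Lp ℍ[ℝ] 2 μ) : qpair μ p q = ∫ x, star (p x) * q x ∂μ :=
  ContinuousLinearMap.lpPairing_eq_integral ..

theorem integrable_star_mul {p q : α → ℍ[ℝ]} (hp : MemLp p 2 μ) (hq : MemLp q 2 μ) :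
    Integrable (fun x => star (p x) * q x) μ :=
  MemLp.integrable_mul (f := fun x => star (p x)) hp.star hq

theorem re_qpair (p q : Lp ℍ[ℝ] 2 μ) : (qpair μ p q).re = inner ℝ p q := by
  have hinner (u v : ℍ[ℝ]) : inner ℝ u v = (star u * v).re := by simp [Quaternion.inner_def]
  rw [L2.inner_def, qpair_apply]
  simp_rw [hinner]
  simpa [hinner] using ((innerSL ℝ (1 : ℍ[ℝ])).integral_comp_comm
    (integrable_star_mul (Lp.memLp p) (Lp.memLp q))).symm

theorem qpair_op_smul_right (p q : Lp ℍ[ℝ] 2 μ) (c : ℍ[ℝ]) :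
    qpair μ p (MulOpposite.op c • q) = qpair μ p q * c := by
  rw [qpair_apply, qpair_apply,
    ← integral_mul_const_of_integrable (integrable_star_mul (Lp.memLp p) (Lp.memLp q))]
  refine integral_congr_ae ?_
  filter_upwards [coeFn_op_smul c q] with x hx
  rw [hx, mul_assoc]

theorem qpair_op_smul_left (p q : Lp ℍ[ℝ] 2 μ) (c : ℍ[ℝ]) :
    qpair μ (MulOpposite.op c • p) q = star c * qpair μ p q := by
  rw [qpair_apply, qpair_apply,
    ← integral_const_mul_of_integrable (integrable_star_mul (Lp.memLp p) (Lp.memLp q))]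
  refine integral_congr_ae ?_
  filter_upwards [coeFn_op_smul c p] with x hx
  rw [hx, star_mul, mul_assoc]

theorem eq_of_re_mul_eq {z w : ℍ[ℝ]} (h : ∀ c, (z * c).re = (w * c).re) : z = w := by
  rw [← sub_eq_zero, ← Quaternion.normSq_eq_zero, ← Quaternion.inner_self, Quaternion.inner_def,
    sub_mul, Quaternion.re_sub, h, sub_self]

end Pairing

/-! ### The space `𝓗` with weak gradients and traces -/

section Derivatives

variable {F F' : Type*} [NormedAddCommGroup F] [NormedSpace ℝ F] [NormedAddCommGroup F']
  [NormedSpace ℝ F'] {U : E3 → F}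

theorem continuous_pd (hU : ContDiff ℝ 1 U) (i : Fin 3) : Continuous (pd i U) :=
  (hU.continuous_fderiv one_ne_zero).clm_apply continuous_const

theorem pd_clm_comp (L : F →L[ℝ] F') (hU : ContDiff ℝ 1 U) (i : Fin 3) (x : E3) :
    pd i (fun y => L (U y)) x = L (pd i U x) :=
  DFunLike.congr_fun (L.hasFDerivAt.comp x (hU.differentiable one_ne_zero x).hasFDerivAt).fderiv _

theorem IsTest.memLp {Ω : Set E3} {φ : E3 → ℝ} (hφ : IsTest Ω φ) : MemLp φ 2 (vol Ω) :=
  (hφ.contDiff.continuous.memLp_of_hasCompactSupport hφ.hasCompactSupport).restrict Ω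

theorem IsTest.memLp_pd {Ω : Set E3} {φ : E3 → ℝ} (hφ : IsTest Ω φ) (i : Fin 3) :
    MemLp (pd i φ) 2 (vol Ω) :=
  ((continuous_pd hφ.contDiff i).memLp_of_hasCompactSupport
    (hφ.hasCompactSupport.fderiv_apply ℝ _)).restrict Ω

end Derivatives

section Graph

variable {Ω : Set E3}

/-- The Hilbert space of triples consisting of a function on `Ω`, a candidate for its weak gradient
and a candidate for its boundary values. -/
def GraphSpace (Ω : Set E3) : Type :=
  WithLp 2 (V Ω × WithLp 2 (PiLp 2 (fun _ : Fin 3 => V Ω) × Lp ℍ[ℝ] 2 (surf Ω)))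

namespace GraphSpace

instance : NormedAddCommGroup (GraphSpace Ω) :=
  inferInstanceAs (NormedAddCommGroup (WithLp 2 _))

instance : InnerProductSpace ℝ (GraphSpace Ω) :=
  inferInstanceAs (InnerProductSpace ℝ (WithLp 2 _))

instance : CompleteSpace (GraphSpace Ω) :=
  inferInstanceAs (CompleteSpace (WithLp 2 _))

instance : Module ℍ[ℝ]ᵐᵒᵖ (GraphSpace Ω) :=
  inferInstanceAs (Module ℍ[ℝ]ᵐᵒᵖ (WithLp 2 _))

instance : ContinuousConstSMul ℍ[ℝ]ᵐᵒᵖ (GraphSpace Ω) :=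
  inferInstanceAs (ContinuousConstSMul ℍ[ℝ]ᵐᵒᵖ (WithLp 2 _))

end GraphSpace

/-- The function component of a triple. -/
def val : GraphSpace Ω →L[ℝ] V Ω :=
  WithLp.fstL 2 ℝ _ _

/-- The `i`-th component of the gradient of a triple. -/
def grad (i : Fin 3) : GraphSpace Ω →L[ℝ] V Ω :=
  PiLp.proj 2 (fun _ : Fin 3 => V Ω) i ∘L WithLp.fstL 2 ℝ _ _ ∘L WithLp.sndL 2 ℝ _ _

/-- The boundary values of a triple. -/
def tr : GraphSpace Ω →L[ℝ] Lp ℍ[ℝ] 2 (surf Ω) :=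
  WithLp.sndL 2 ℝ _ _ ∘L WithLp.sndL 2 ℝ _ _

/-- The triple with given components. -/
def triple (u : V Ω) (Du : Fin 3 → V Ω) (g : Lp ℍ[ℝ] 2 (surf Ω)) : GraphSpace Ω :=
  WithLp.toLp 2 (u, WithLp.toLp 2 (WithLp.toLp 2 Du, g))

theorem val_op_smul (c : ℍ[ℝ]ᵐᵒᵖ) (x : GraphSpace Ω) : val (c • x) = c • val x := rfl

theorem grad_op_smul (c : ℍ[ℝ]ᵐᵒᵖ) (x : GraphSpace Ω) (i : Fin 3) :
    grad i (c • x) = c • grad i x := rfl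

theorem tr_op_smul (c : ℍ[ℝ]ᵐᵒᵖ) (x : GraphSpace Ω) : tr (c • x) = c • tr x := rfl

theorem graph_norm_sq (x : GraphSpace Ω) :
    ‖x‖ ^ 2 = ‖val x‖ ^ 2 + (∑ i, ‖grad i x‖ ^ 2 + ‖tr x‖ ^ 2) := by
  refine (WithLp.prod_norm_sq_eq_of_L2 _).trans ?_
  rw [WithLp.prod_norm_sq_eq_of_L2, PiLp.norm_sq_eq_of_L2]
  rfl

theorem tendsto_triple {u : ℕ → V Ω} {Du : Fin 3 → ℕ → V Ω} {g : ℕ → Lp ℍ[ℝ] 2 (surf Ω)}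
    {x : GraphSpace Ω} (hu : Tendsto u atTop (𝓝 (val x)))
    (hDu : ∀ i, Tendsto (Du i) atTop (𝓝 (grad i x))) (hg : Tendsto g atTop (𝓝 (tr x))) :
    Tendsto (fun n => triple (u n) (fun i => Du i n) (g n)) atTop (𝓝 x) :=
  ((WithLp.prod_continuous_toLp 2 _ _).tendsto _).comp <| hu.prodMk_nhds <|
    ((WithLp.prod_continuous_toLp 2 _ _).tendsto _).comp <|
      (((PiLp.continuous_toLp 2 _).tendsto _).comp (tendsto_pi_nhds.2 hDu)).prodMk_nhds hg

/-- The triples `(U, ∇U, U)` of the functions `U` that are of class `C¹` on the whole space. -/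
def smoothGraph (Ω : Set E3) : Submodule ℝ (GraphSpace Ω) where
  carrier := {x | ∃ U : E3 → ℍ[ℝ], ContDiff ℝ 1 U ∧ val x =ᵐ[vol Ω] U ∧
    (∀ i, grad i x =ᵐ[vol Ω] pd i U) ∧ tr x =ᵐ[surf Ω] U}
  zero_mem' := by
    refine ⟨0, contDiff_const, ?_, fun i => ?_, ?_⟩ <;> rw [map_zero]
    · exact Lp.coeFn_zero _ _ _
    · refine (Lp.coeFn_zero ℍ[ℝ] 2 (vol Ω)).trans (Eventually.of_forall fun x => ?_)
      simp [pd]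
    · exact Lp.coeFn_zero _ _ _
  add_mem' := by
    rintro x y ⟨U, hU, hxU, hxDU, hxtr⟩ ⟨W, hW, hyW, hyDW, hytr⟩
    refine ⟨U + W, hU.add hW, ?_, fun i => ?_, ?_⟩ <;> rw [map_add]
    · exact (Lp.coeFn_add _ _).trans (hxU.add hyW)
    · filter_upwards [Lp.coeFn_add (grad i x) (grad i y), hxDU i, hyDW i] with z hz hzU hzW
      rw [hz, Pi.add_apply, hzU, hzW, pd, pd, pd, fderiv_add (hU.differentiable one_ne_zero z)
        (hW.differentiable one_ne_zero z), add_apply]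
    · exact (Lp.coeFn_add _ _).trans (hxtr.add hytr)
  smul_mem' := by
    rintro c x ⟨U, hU, hxU, hxDU, hxtr⟩
    refine ⟨c • U, hU.const_smul c, ?_, fun i => ?_, ?_⟩ <;> rw [map_smul]
    · exact (Lp.coeFn_smul _ _).trans (hxU.const_smul c)
    · filter_upwards [Lp.coeFn_smul c (grad i x), hxDU i] with z hz hzU
      rw [hz, Pi.smul_apply, hzU, pd, pd, fderiv_const_smul (hU.differentiable one_ne_zero z),
        smul_apply]
    · exact (Lp.coeFn_smul _ _).trans (hxtr.const_smul c)

theorem op_smul_mem_smoothGraph (c : ℍ[ℝ]) {x : GraphSpace Ω} (hx : x ∈ smoothGraph Ω) :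
    MulOpposite.op c • x ∈ smoothGraph Ω := by
  obtain ⟨U, hU, hxU, hxDU, hxtr⟩ := hx
  let rmul : ℍ[ℝ] →L[ℝ] ℍ[ℝ] := (ContinuousLinearMap.mul ℝ ℍ[ℝ]).flip c
  refine ⟨fun y => rmul (U y), rmul.contDiff.comp hU, ?_, fun i => ?_, ?_⟩
  · filter_upwards [coeFn_op_smul c (val x), hxU] with y hy hyU
    rw [val_op_smul, hy, hyU]
    rfl
  · filter_upwards [coeFn_op_smul c (grad i x), hxDU i] with y hy hyDU
    rw [grad_op_smul, hy, hyDU, pd_clm_comp _ hU]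
    rfl
  · filter_upwards [coeFn_op_smul c (tr x), hxtr] with y hy hytr
    rw [tr_op_smul, hy, hytr]
    rfl

theorem memLp_of_eLpNorm_sub_lt_top {α F : Type*} [MeasurableSpace α] {μ : Measure α}
    [NormedAddCommGroup F] {p : ℝ≥0∞} {f g : α → F} (hf : AEStronglyMeasurable f μ)
    (hg : MemLp g p μ) (h : eLpNorm (fun x => f x - g x) p μ < ∞) : MemLp f p μ := by
  have hsub : MemLp (f - g) p μ := ⟨hf.sub hg.1, h⟩
  simpa using hsub.add hg

theorem IsTrace.mem_closure {x : GraphSpace Ω}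
    (hx : IsTrace Ω (val x) (fun i => grad i x) (tr x)) :
    x ∈ (smoothGraph Ω).topologicalClosure := by
  obtain ⟨-, U, hU, hu, hDu, hg⟩ := hx
  have hfin {f : ℕ → ℝ≥0∞} (hf : Tendsto f atTop (𝓝 0)) : ∀ᶠ n in atTop, f n < ∞ :=
    hf.eventually_lt_const ENNReal.zero_lt_top
  obtain ⟨N, hN⟩ := eventually_atTop.1
    ((hfin hu).and ((eventually_all.2 fun i => hfin (hDu i)).and (hfin hg)))
  have memU n : MemLp (U (n + N)) 2 (vol Ω) := memLp_of_eLpNorm_sub_lt_top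
    (hU _).continuous.aestronglyMeasurable (Lp.memLp _) (hN (n + N) (Nat.le_add_left _ _)).1
  have memDU i n : MemLp (pd i (U (n + N))) 2 (vol Ω) := memLp_of_eLpNorm_sub_lt_top
    (continuous_pd (hU _) i).aestronglyMeasurable (Lp.memLp _)
    ((hN (n + N) (Nat.le_add_left _ _)).2.1 i)
  have memtr n : MemLp (U (n + N)) 2 (surf Ω) := memLp_of_eLpNorm_sub_lt_top
    (hU _).continuous.aestronglyMeasurable (Lp.memLp _) (hN (n + N) (Nat.le_add_left _ _)).2.2
  have htoLp {μ : Measure E3} {W : ℕ → E3 → ℍ[ℝ]} {w : Lp ℍ[ℝ] 2 μ}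
      (hW : ∀ n, MemLp (W (n + N)) 2 μ)
      (h : Tendsto (fun n => eLpNorm (fun x => W n x - w x) 2 μ) atTop (𝓝 0)) :
      Tendsto (fun n => (hW n).toLp (W (n + N))) atTop (𝓝 w) := by
    rw [← Lp.toLp_coeFn w (Lp.memLp w), Lp.tendsto_Lp_iff_tendsto_eLpNorm'']
    exact (tendsto_add_atTop_iff_nat N).2 h
  exact mem_closure_of_tendsto
    (tendsto_triple (htoLp memU hu) (fun i => htoLp (memDU i) (hDu i)) (htoLp memtr hg))
    (Eventually.of_forall fun n => ⟨U (n + N), hU _, (memU n).coeFn_toLp,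
      fun i => (memDU i n).coeFn_toLp, (memtr n).coeFn_toLp⟩)

theorem isTrace_iff_mem_closure {x : GraphSpace Ω} :
    IsTrace Ω (val x) (fun i => grad i x) (tr x) ↔ x ∈ (smoothGraph Ω).topologicalClosure := by
  refine ⟨IsTrace.mem_closure, fun hx => ?_⟩
  obtain ⟨y, hy, hyx⟩ := mem_closure_iff_seq_limit.1 hx
  choose U hU hyU hyDU hytr using hy
  have htendsto {μ : Measure E3} (P : GraphSpace Ω →L[ℝ] Lp ℍ[ℝ] 2 μ) (W : ℕ → E3 → ℍ[ℝ])
      (hW : ∀ n, P (y n) =ᵐ[μ] W n) :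
      Tendsto (fun n => eLpNorm (fun z => W n z - P x z) 2 μ) atTop (𝓝 0) := by
    refine ((Lp.tendsto_Lp_iff_tendsto_eLpNorm' _ _).1
      ((P.continuous.tendsto x).comp hyx)).congr fun n => eLpNorm_congr_ae ?_
    filter_upwards [hW n] with z hz
    simp [hz]
  exact ⟨Lp.memLp _, U, hU, htendsto val U hyU, fun i => htendsto (grad i) _ fun n => hyDU n i,
    htendsto tr U hytr⟩

end Graph

section MeanZero

variable {Ω : Set E3}

/-- The functional `f ↦ ∫ ψ f` on `L²(Ω, ℍ)` for a square integrable real function `ψ`. -/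
def testInt {ψ : E3 → ℝ} (hψ : MemLp ψ 2 (vol Ω)) : V Ω →L[ℝ] ℍ[ℝ] :=
  (ContinuousLinearMap.lsmul ℝ ℝ).lpPairing (vol Ω) 2 2 (hψ.toLp ψ)

theorem testInt_apply {ψ : E3 → ℝ} (hψ : MemLp ψ 2 (vol Ω)) (f : V Ω) :
    testInt hψ f = ∫ x in Ω, ψ x • f x := by
  rw [testInt, ContinuousLinearMap.lpPairing_eq_integral]
  refine integral_congr_ae ?_
  filter_upwards [hψ.coeFn_toLp] with x hx
  simp [hx]

theorem testInt_op_smul {ψ : E3 → ℝ} (hψ : MemLp ψ 2 (vol Ω)) (c : ℍ[ℝ]) (f : V Ω) :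
    testInt hψ (MulOpposite.op c • f) = testInt hψ f * c := by
  have hint : Integrable (fun x => ψ x • f x) (vol Ω) :=
    memLp_one_iff_integrable.1 ((Lp.memLp f).smul hψ)
  rw [testInt_apply, testInt_apply, ← integral_mul_const_of_integrable hint]
  refine integral_congr_ae ?_
  filter_upwards [coeFn_op_smul c f] with x hx
  rw [hx, smul_mul_assoc]

variable [IsFiniteMeasure (vol Ω)]

/-- The space `𝓗` of mean zero functions in `H¹(Ω, ℍ)`, each one taken together with its weak
gradient and its trace. -/
def meanZeroH1 (Ω : Set E3) [IsFiniteMeasure (vol Ω)] : Submodule ℝ (GraphSpace Ω) :=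
  (smoothGraph Ω).topologicalClosure ⊓
    (⨅ i : Fin 3, ⨅ φ : {φ : E3 → ℝ // IsTest Ω φ},
      (testInt φ.2.memLp ∘L grad i + testInt (φ.2.memLp_pd i) ∘L val).ker) ⊓
    (testInt (memLp_const (1 : ℝ)) ∘L val).ker

theorem mem_meanZeroH1 {x : GraphSpace Ω} :
    x ∈ meanZeroH1 Ω ↔ IsMeanZeroH1 Ω (val x) (fun i => grad i x) (tr x) := by
  simp only [meanZeroH1, Submodule.mem_inf, Submodule.mem_iInf, Subtype.forall,
    ← isTrace_iff_mem_closure, LinearMap.mem_ker, ContinuousLinearMap.coe_coe, add_apply,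
    ContinuousLinearMap.comp_apply, testInt_apply, one_smul, add_eq_zero_iff_eq_neg]
  exact ⟨fun h => ⟨⟨Lp.memLp _, fun i => Lp.memLp _, h.1.2⟩, h.1.1, h.2⟩,
    fun h => ⟨⟨h.isTrace, h.isH1.weak_deriv⟩, h.mean_zero⟩⟩

theorem isClosed_meanZeroH1 : IsClosed (meanZeroH1 Ω : Set (GraphSpace Ω)) := by
  simp only [meanZeroH1, Submodule.coe_inf, Submodule.coe_iInf]
  exact ((Submodule.isClosed_topologicalClosure _).inter
    (isClosed_iInter fun i => isClosed_iInter fun φ => ContinuousLinearMap.isClosed_ker _)).inter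
    (ContinuousLinearMap.isClosed_ker _)

instance : CompleteSpace (meanZeroH1 Ω) := isClosed_meanZeroH1.completeSpace_coe

theorem op_smul_mem_meanZeroH1 (c : ℍ[ℝ]) {x : GraphSpace Ω} (hx : x ∈ meanZeroH1 Ω) :
    MulOpposite.op c • x ∈ meanZeroH1 Ω := by
  simp only [meanZeroH1, Submodule.mem_inf, Submodule.mem_iInf, LinearMap.mem_ker,
    ContinuousLinearMap.coe_coe, add_apply, ContinuousLinearMap.comp_apply,
    val_op_smul, grad_op_smul, testInt_op_smul] at hx ⊢
  refine ⟨⟨?_, fun i φ => ?_⟩, ?_⟩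
  · exact map_mem_closure (continuous_const_smul (MulOpposite.op c)) hx.1.1
      fun _ hy => op_smul_mem_smoothGraph c hy
  · rw [← add_mul, hx.1.2 i φ, zero_mul]
  · rw [hx.2, zero_mul]

end MeanZero

section Components

variable {Ω : Set E3} {F F' : Type*} [NormedAddCommGroup F] [NormedAddCommGroup F']

theorem IsH1.clm_comp [NormedSpace ℝ F] [CompleteSpace F] [NormedSpace ℝ F'] [CompleteSpace F']
    (L : F →L[ℝ] F') {u : E3 → F} {Du : Fin 3 → E3 → F} (h : IsH1 Ω u Du) :
    IsH1 Ω (fun x => L (u x)) (fun i x => L (Du i x)) where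
  memLp := L.comp_memLp' h.memLp
  memLp_deriv i := L.comp_memLp' (h.memLp_deriv i)
  weak_deriv i φ hφ := by
    have hφDu : Integrable (fun x => φ x • Du i x) (vol Ω) :=
      memLp_one_iff_integrable.1 ((h.memLp_deriv i).smul hφ.memLp)
    have hDφu : Integrable (fun x => pd i φ x • u x) (vol Ω) :=
      memLp_one_iff_integrable.1 (h.memLp.smul (hφ.memLp_pd i))
    simp_rw [← map_smul]
    rw [L.integral_comp_comm hφDu, L.integral_comp_comm hDφu, h.weak_deriv i φ hφ, map_neg]

theorem tendsto_eLpNorm_clm_comp [NormedSpace ℝ F] [NormedSpace ℝ F'] (L : F →L[ℝ] F')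
    {μ : Measure E3} {w : ℕ → E3 → F} (h : Tendsto (fun n => eLpNorm (w n) 2 μ) atTop (𝓝 0)) :
    Tendsto (fun n => eLpNorm (fun x => L (w n x)) 2 μ) atTop (𝓝 0) := by
  have hmul : Tendsto (fun n => ENNReal.ofReal ‖L‖ * eLpNorm (w n) 2 μ) atTop (𝓝 0) := by
    simpa using ENNReal.Tendsto.const_mul (a := ENNReal.ofReal ‖L‖) h
      (Or.inr ENNReal.ofReal_ne_top)
  exact tendsto_of_tendsto_of_tendsto_of_le_of_le tendsto_const_nhds hmul (fun _ => zero_le)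
    fun n => eLpNorm_le_mul_eLpNorm_of_ae_le_mul (Eventually.of_forall fun x => L.le_opNorm _) 2

theorem IsTrace.clm_comp [NormedSpace ℝ F] [NormedSpace ℝ F'] (L : F →L[ℝ] F') {u : E3 → F}
    {Du : Fin 3 → E3 → F} {g : E3 → F} (h : IsTrace Ω u Du g) :
    IsTrace Ω (fun x => L (u x)) (fun i x => L (Du i x)) (fun x => L (g x)) := by
  obtain ⟨hg, U, hU, hu, hDu, htr⟩ := h
  refine ⟨L.comp_memLp' hg, fun n x => L (U n x), fun n => L.contDiff.comp (hU n), ?_,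
    fun i => ?_, ?_⟩
  · simpa only [map_sub] using tendsto_eLpNorm_clm_comp L hu
  · simpa only [map_sub, pd_clm_comp L (hU _)] using tendsto_eLpNorm_clm_comp L (hDu i)
  · simpa only [map_sub] using tendsto_eLpNorm_clm_comp L htr

theorem enorm_sq_eq_ofReal (z : F) : ‖z‖ₑ ^ 2 = ENNReal.ofReal (‖z‖ ^ 2) := by
  rw [← ofReal_norm, ENNReal.ofReal_pow (norm_nonneg _)]

theorem eLpNorm_two_sq (f : E3 → F) (μ : Measure E3) :
    eLpNorm f 2 μ ^ 2 = ∫⁻ x, ‖f x‖ₑ ^ 2 ∂μ := by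
  simpa using eLpNorm_nnreal_pow_eq_lintegral (f := f) (μ := μ) (p := 2) two_ne_zero

theorem ofReal_norm_sq_Lp {μ : Measure E3} (f : Lp F 2 μ) :
    ENNReal.ofReal (‖f‖ ^ 2) = eLpNorm f 2 μ ^ 2 := by
  rw [← enorm_sq_eq_ofReal, Lp.enorm_def]

theorem rpow_half_sq (z : ℝ≥0∞) : (z ^ (1 / 2 : ℝ)) ^ 2 = z := by
  rw [← ENNReal.rpow_natCast, ← ENNReal.rpow_mul]
  norm_num

variable [InnerProductSpace ℝ F]

theorem eLpNorm_sq_eq_sum_inner {ι : Type*} [Fintype ι] (β : OrthonormalBasis ι ℝ F)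
    {f : E3 → F} {μ : Measure E3} (hf : AEStronglyMeasurable f μ) :
    eLpNorm f 2 μ ^ 2 = ∑ c, eLpNorm (fun x => innerSL ℝ (β c) (f x)) 2 μ ^ 2 := by
  simp_rw [eLpNorm_two_sq]
  rw [← lintegral_finsetSum' _ fun c _ =>
    (((innerSL ℝ (β c)).continuous.comp_aestronglyMeasurable hf).enorm.pow_const 2)]
  refine lintegral_congr fun x => ?_
  rw [enorm_sq_eq_ofReal, ← β.sum_sq_norm_inner_right,
    ENNReal.ofReal_sum_of_nonneg fun _ _ => by positivity]
  simp_rw [enorm_sq_eq_ofReal]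
  rfl

variable [FiniteDimensional ℝ F]

theorem IsPoincareWirtingerConstant.eLpNorm_sq_le [IsFiniteMeasure (vol Ω)] {CP : ℝ}
    (hCP : IsPoincareWirtingerConstant Ω CP) {u : E3 → F} {Du : Fin 3 → E3 → F}
    (h : IsH1 Ω u Du) (hmean : ∫ x in Ω, u x = 0) :
    eLpNorm u 2 (vol Ω) ^ 2 ≤ ENNReal.ofReal (CP ^ 2) * ∑ i, eLpNorm (Du i) 2 (vol Ω) ^ 2 := by
  have := FiniteDimensional.complete ℝ F
  let β := stdOrthonormalBasis ℝ F
  rw [eLpNorm_sq_eq_sum_inner β h.memLp.1]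
  simp_rw [fun i => eLpNorm_sq_eq_sum_inner β (h.memLp_deriv i).1]
  rw [Finset.sum_comm, Finset.mul_sum]
  refine Finset.sum_le_sum fun c _ => ?_
  have hscalar := hCP.2 _ _ (h.clm_comp (innerSL ℝ (β c)))
  have haverage : ⨍ y in Ω, innerSL ℝ (β c) (u y) = 0 := by
    rw [average_eq, (innerSL ℝ (β c)).integral_comp_comm (h.memLp.integrable one_le_two), hmean,
      map_zero, smul_zero]
  simp only [haverage, sub_zero] at hscalar
  simpa only [mul_pow, gradNorm, rpow_half_sq, ← ENNReal.ofReal_pow hCP.1.le]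
    using pow_le_pow_left' hscalar 2

theorem IsTraceConstant.eLpNorm_sq_le {C : ℝ} (hC : IsTraceConstant Ω C) {u g : E3 → F}
    {Du : Fin 3 → E3 → F} (h : IsH1 Ω u Du) (hg : IsTrace Ω u Du g) :
    eLpNorm g 2 (surf Ω) ^ 2 ≤
      ENNReal.ofReal (C ^ 2) * (eLpNorm u 2 (vol Ω) ^ 2 + ∑ i, eLpNorm (Du i) 2 (vol Ω) ^ 2) := by
  have := FiniteDimensional.complete ℝ F
  let β := stdOrthonormalBasis ℝ F
  rw [eLpNorm_sq_eq_sum_inner β hg.1.1, eLpNorm_sq_eq_sum_inner β h.memLp.1]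
  simp_rw [fun i => eLpNorm_sq_eq_sum_inner β (h.memLp_deriv i).1]
  rw [Finset.sum_comm, ← Finset.sum_add_distrib, Finset.mul_sum]
  refine Finset.sum_le_sum fun c _ => ?_
  have hscalar := pow_le_pow_left'
    (hC.2 _ _ _ (h.clm_comp (innerSL ℝ (β c))) (hg.clm_comp (innerSL ℝ (β c)))) 2
  rw [mul_pow, hHalfNorm, h1Norm, rpow_half_sq, rpow_half_sq, ← ENNReal.ofReal_pow hC.1.le,
    ← eLpNorm_two_sq] at hscalar
  exact le_self_add.trans hscalar

variable [IsFiniteMeasure (vol Ω)]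

theorem norm_val_sq_le {CP : ℝ} (hCP : IsPoincareWirtingerConstant Ω CP) {x : GraphSpace Ω}
    (hx : x ∈ meanZeroH1 Ω) : ‖val x‖ ^ 2 ≤ CP ^ 2 * ∑ i, ‖grad i x‖ ^ 2 := by
  have h := mem_meanZeroH1.1 hx
  rw [← ENNReal.ofReal_le_ofReal_iff (by positivity), ENNReal.ofReal_mul (by positivity),
    ENNReal.ofReal_sum_of_nonneg fun _ _ => by positivity]
  simpa only [ofReal_norm_sq_Lp] using hCP.eLpNorm_sq_le h.isH1 h.mean_zero

theorem norm_tr_sq_le {C : ℝ} (hC : IsTraceConstant Ω C) {x : GraphSpace Ω}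
    (hx : x ∈ meanZeroH1 Ω) :
    ‖tr x‖ ^ 2 ≤ C ^ 2 * (‖val x‖ ^ 2 + ∑ i, ‖grad i x‖ ^ 2) := by
  have h := mem_meanZeroH1.1 hx
  rw [← ENNReal.ofReal_le_ofReal_iff (by positivity), ENNReal.ofReal_mul (by positivity),
    ENNReal.ofReal_add (by positivity) (by positivity),
    ENNReal.ofReal_sum_of_nonneg fun _ _ => by positivity]
  simpa only [ofReal_norm_sq_Lp] using hC.eLpNorm_sq_le h.isH1 h.isTrace

end Components

/-! ### The quaternionic Robin form -/

section Coefficients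

variable {Ω : Set E3} {a : Fin 3 → E3 → ℝ} {b : E3 → ℝ}

/-- The regularity of the open set and of the coefficients that the form method uses: the suprema
in `constT'` and `constK` are finite, the `a_ℓ` are bounded and of class `C¹` inside `Ω`, and `b` is
measurable on the boundary. -/
structure IsAdmissible (Ω : Set E3) (a : Fin 3 → E3 → ℝ) (b : E3 → ℝ) : Prop where
  isOpen : IsOpen Ω
  contDiffOn : ∀ l, ContDiffOn ℝ 1 (a l) Ω
  bddAbove_coeff : ∀ l, BddAbove (Set.range fun x : Ω => |a l x|)
  bddAbove_mul_pd : ∀ i l, BddAbove (Set.range fun x : Ω => |a l x * pd l (a i) x|)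
  aestronglyMeasurable_boundary : AEStronglyMeasurable b (surf Ω)
  bddAbove_boundary : BddAbove (Set.range fun x : frontier Ω => |b x|)

theorem bddAbove_range_abs_of_continuousOn {X : Type*} [TopologicalSpace X] {K S : Set X}
    (hK : IsCompact K) (hSK : S ⊆ K) {f : X → ℝ} (hf : ContinuousOn f K) :
    BddAbove (Set.range fun x : S => |f x|) :=
  (hK.bddAbove_image hf.abs).mono
    (Set.range_subset_iff.2 fun x => Set.mem_image_of_mem (|f ·|) (hSK x.2))

theorem IsBoundedC1Domain.isFiniteMeasure (hΩ : IsBoundedC1Domain Ω) : IsFiniteMeasure (vol Ω) :=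
  isFiniteMeasure_restrict.2 hΩ.isBounded.measure_lt_top.ne

theorem IsBoundedC1Domain.isAdmissible (hΩ : IsBoundedC1Domain Ω)
    (hb : ContinuousOn b (frontier Ω)) (ha : ∀ l, IsC1Closure Ω (a l)) : IsAdmissible Ω a b where
  isOpen := hΩ.isOpen
  contDiffOn l := (ha l).contDiffOn
  bddAbove_coeff l := bddAbove_range_abs_of_continuousOn hΩ.isBounded.isCompact_closure
    subset_closure (ha l).continuousOn
  bddAbove_mul_pd i l := by
    obtain ⟨G, hG, hGa⟩ := (ha i).extends_deriv
    have hbdd := bddAbove_range_abs_of_continuousOn hΩ.isBounded.isCompact_closure subset_closure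
      ((ha l).continuousOn.mul (hG.clm_apply (continuousOn_const (c := EuclideanSpace.single l 1))))
    simpa only [pd, hGa _ (Subtype.prop _), Pi.mul_apply] using hbdd
  aestronglyMeasurable_boundary := hb.aestronglyMeasurable isClosed_frontier.measurableSet
  bddAbove_boundary := bddAbove_range_abs_of_continuousOn
    (hΩ.isBounded.isCompact_closure.of_isClosed_subset isClosed_frontier frontier_subset_closure)
    subset_rfl hb

theorem ae_abs_le_iSup {α : Type*} [MeasurableSpace α] {μ : Measure α} {S : Set α} {f : α → ℝ}
    (hS : MeasurableSet S) (hf : BddAbove (Set.range fun x : S => |f x|)) :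
    ∀ᵐ x ∂μ.restrict S, |f x| ≤ ⨆ x : S, |f x| := by
  filter_upwards [ae_restrict_mem hS] with x hx using le_ciSup hf ⟨x, hx⟩

namespace IsAdmissible

theorem memLp_coeff (h : IsAdmissible Ω a b) (l : Fin 3) : MemLp (a l) ∞ (vol Ω) :=
  memLp_top_of_bound
    ((h.contDiffOn l).continuousOn.aestronglyMeasurable h.isOpen.measurableSet) _
    (ae_abs_le_iSup h.isOpen.measurableSet (h.bddAbove_coeff l))

theorem memLp_mul_pd (h : IsAdmissible Ω a b) (i l : Fin 3) :
    MemLp (fun x => a l x * pd l (a i) x) ∞ (vol Ω) := by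
  have hpd : ContinuousOn (pd l (a i)) Ω :=
    ((h.contDiffOn i).continuousOn_fderiv_of_isOpen h.isOpen le_rfl).clm_apply continuousOn_const
  exact memLp_top_of_bound
    (((h.contDiffOn l).continuousOn.mul hpd).aestronglyMeasurable h.isOpen.measurableSet) _
    (ae_abs_le_iSup h.isOpen.measurableSet (h.bddAbove_mul_pd i l))

theorem memLp_boundary (h : IsAdmissible Ω a b) : MemLp b ∞ (surf Ω) :=
  memLp_top_of_bound h.aestronglyMeasurable_boundary _
    (ae_abs_le_iSup isClosed_frontier.measurableSet h.bddAbove_boundary)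

end IsAdmissible

theorem constT_le_sq (l : Fin 3) {x : E3} (hx : x ∈ Ω) : constT Ω a ≤ a l x ^ 2 :=
  (ciInf_le (Set.finite_range _).bddBelow l).trans
    (ciInf_le (f := fun x : Ω => a l x ^ 2)
      ⟨0, Set.forall_mem_range.2 fun _ => sq_nonneg _⟩ ⟨x, hx⟩)

theorem constT'_nonneg : 0 ≤ constT' Ω a :=
  Finset.sum_nonneg fun _ _ => Finset.sum_nonneg fun _ _ => Real.iSup_nonneg fun _ => abs_nonneg _

theorem norm_e (l : Fin 3) : ‖e l‖ = 1 := by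
  have hsq : ‖e l‖ ^ 2 = 1 := by
    rw [sq, ← Quaternion.normSq_eq_norm_mul_self, Quaternion.normSq_def']
    fin_cases l <;> simp [e]
  exact (pow_eq_one_iff_of_nonneg (norm_nonneg _) two_ne_zero).1 hsq

end Coefficients

section Form

variable {Ω : Set E3} {a : Fin 3 → E3 → ℝ} {b : E3 → ℝ}

/-- The factor of `a_ℓ (∂_ℓ a_i) ∂_i u` in the terms of the form that pair derivatives of `u` with
`v`: the units `e_ℓ e_i` for `ℓ ≠ i` come from the vector part of `T²`, and the terms with `ℓ = i`
from `½ ∂_ℓ (a_ℓ²) = a_ℓ ∂_ℓ a_ℓ`. -/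
def lowerUnit (i l : Fin 3) : ℍ[ℝ] := if l = i then 1 else e l * e i

theorem norm_lowerUnit (i l : Fin 3) : ‖lowerUnit i l‖ = 1 := by
  unfold lowerUnit
  split_ifs <;> simp [norm_e]

/-- The operator `u ↦ ∑ ε(i, ℓ) a_ℓ (∂_ℓ a_i) ∂_i u` that collects the first order terms of the
form. -/
def lowerTerms (h : IsAdmissible Ω a b) : GraphSpace Ω →L[ℝ] V Ω :=
  ∑ i, ∑ l, lowerUnit i l • (mulReal (h.memLp_mul_pd i l) ∘L grad i)

theorem lowerTerms_apply (h : IsAdmissible Ω a b) (x : GraphSpace Ω) :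
    lowerTerms h x = ∑ i, ∑ l, lowerUnit i l • mulReal (h.memLp_mul_pd i l) (grad i x) := by
  simp [lowerTerms]

theorem lowerTerms_op_smul (h : IsAdmissible Ω a b) (c : ℍ[ℝ]) (x : GraphSpace Ω) :
    lowerTerms h (MulOpposite.op c • x) = MulOpposite.op c • lowerTerms h x := by
  simp only [lowerTerms_apply, grad_op_smul, mulReal_op_smul, Finset.smul_sum,
    smul_comm (MulOpposite.op c)]

/-- The quaternionic form of `T²` with the Robin condition, that is, the form of `Q_s(T)` for
`s = 0`. -/
def robinPair (h : IsAdmissible Ω a b) : GraphSpace Ω →L[ℝ] GraphSpace Ω →L[ℝ] ℍ[ℝ] :=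
  ∑ l, (qpair (vol Ω)).bilinearComp (mulReal (h.memLp_coeff l) ∘L grad l)
      (mulReal (h.memLp_coeff l) ∘L grad l) +
    (qpair (vol Ω)).bilinearComp (lowerTerms h) val +
    (qpair (surf Ω)).bilinearComp (mulReal h.memLp_boundary ∘L tr) tr

theorem robinPair_apply (h : IsAdmissible Ω a b) (x y : GraphSpace Ω) :
    robinPair h x y =
      ∑ l, qpair (vol Ω) (mulReal (h.memLp_coeff l) (grad l x))
        (mulReal (h.memLp_coeff l) (grad l y)) +
      qpair (vol Ω) (lowerTerms h x) (val y) +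
      qpair (surf Ω) (mulReal h.memLp_boundary (tr x)) (tr y) := by
  simp [robinPair]

theorem robinPair_op_smul_left (h : IsAdmissible Ω a b) (c : ℍ[ℝ]) (x y : GraphSpace Ω) :
    robinPair h (MulOpposite.op c • x) y = star c * robinPair h x y := by
  simp only [robinPair_apply, grad_op_smul, tr_op_smul, mulReal_op_smul, lowerTerms_op_smul,
    qpair_op_smul_left, mul_add, Finset.mul_sum]

theorem robinPair_op_smul_right (h : IsAdmissible Ω a b) (c : ℍ[ℝ]) (x y : GraphSpace Ω) :
    robinPair h x (MulOpposite.op c • y) = robinPair h x y * c := by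
  simp only [robinPair_apply, grad_op_smul, tr_op_smul, val_op_smul, mulReal_op_smul,
    qpair_op_smul_right, add_mul, Finset.sum_mul]

theorem constT_mul_le (h : IsAdmissible Ω a b) (x : GraphSpace Ω) :
    constT Ω a * ∑ i, ‖grad i x‖ ^ 2 ≤ ∑ l, ‖mulReal (h.memLp_coeff l) (grad l x)‖ ^ 2 := by
  rw [Finset.mul_sum]
  refine Finset.sum_le_sum fun l _ => mul_norm_sq_le_norm_mulReal_sq _ ?_ _
  filter_upwards [ae_restrict_mem h.isOpen.measurableSet] with y hy using constT_le_sq l hy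

theorem norm_lowerTerms_le (h : IsAdmissible Ω a b) (x : GraphSpace Ω) :
    ‖lowerTerms h x‖ ≤ constT' Ω a * √(∑ i, ‖grad i x‖ ^ 2) := by
  rw [lowerTerms_apply, constT', Finset.sum_mul]
  refine norm_sum_le_of_le _ fun i _ => ?_
  rw [Finset.sum_mul]
  refine norm_sum_le_of_le _ fun l _ => ?_
  have hgrad : ‖grad i x‖ ≤ √(∑ i, ‖grad i x‖ ^ 2) := Real.le_sqrt_of_sq_le
    (Finset.single_le_sum (f := fun i => ‖grad i x‖ ^ 2) (fun _ _ => by positivity)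
      (Finset.mem_univ i))
  have hsup : 0 ≤ ⨆ x : Ω, |a l x * pd l (a i) x| := Real.iSup_nonneg fun _ => abs_nonneg _
  calc ‖lowerUnit i l • mulReal (h.memLp_mul_pd i l) (grad i x)‖
      ≤ ‖mulReal (h.memLp_mul_pd i l) (grad i x)‖ := by
        simpa [norm_lowerUnit] using
          norm_smul_le (lowerUnit i l) (mulReal (h.memLp_mul_pd i l) (grad i x))
    _ ≤ (⨆ x : Ω, |a l x * pd l (a i) x|) * ‖grad i x‖ := norm_mulReal_le _
        (ae_abs_le_iSup h.isOpen.measurableSet (h.bddAbove_mul_pd i l)) _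
    _ ≤ _ := by gcongr

variable [IsFiniteMeasure (vol Ω)] {Ctr CP : ℝ}

theorem neg_le_inner_lowerTerms (h : IsAdmissible Ω a b) (hCP : IsPoincareWirtingerConstant Ω CP)
    {x : GraphSpace Ω} (hx : x ∈ meanZeroH1 Ω) :
    -(constT' Ω a * CP * ∑ i, ‖grad i x‖ ^ 2) ≤ inner ℝ (lowerTerms h x) (val x) := by
  set G := ∑ i, ‖grad i x‖ ^ 2
  have hG : 0 ≤ G := by positivity
  have hval : ‖val x‖ ≤ CP * √G := by
    rw [← Real.sqrt_sq hCP.1.le, ← Real.sqrt_mul (sq_nonneg CP)]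
    exact Real.le_sqrt_of_sq_le (norm_val_sq_le hCP hx)
  refine (neg_le_neg ?_).trans (neg_le_of_abs_le (abs_real_inner_le_norm _ _))
  calc ‖lowerTerms h x‖ * ‖val x‖ ≤ (constT' Ω a * √G) * (CP * √G) := by
        have := constT'_nonneg (Ω := Ω) (a := a)
        gcongr
        exact norm_lowerTerms_le h x
    _ = constT' Ω a * CP * G := by rw [mul_mul_mul_comm, Real.mul_self_sqrt hG]

theorem neg_le_inner_boundary (h : IsAdmissible Ω a b) (hCtr : IsTraceConstant Ω Ctr)
    (hCP : IsPoincareWirtingerConstant Ω CP) {x : GraphSpace Ω} (hx : x ∈ meanZeroH1 Ω) :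
    -(constK Ω b Ctr * (1 + CP ^ 2) * ∑ i, ‖grad i x‖ ^ 2) ≤
      inner ℝ (mulReal h.memLp_boundary (tr x)) (tr x) := by
  set G := ∑ i, ‖grad i x‖ ^ 2
  set β := ⨆ x : frontier Ω, |b x| with hβ
  have hβ0 : 0 ≤ β := Real.iSup_nonneg fun _ => abs_nonneg _
  refine (neg_le_neg ?_).trans (neg_le_of_abs_le (abs_real_inner_le_norm _ _))
  calc ‖mulReal h.memLp_boundary (tr x)‖ * ‖tr x‖ ≤ β * ‖tr x‖ * ‖tr x‖ := by
        gcongr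
        exact norm_mulReal_le _
          (ae_abs_le_iSup isClosed_frontier.measurableSet h.bddAbove_boundary) _
    _ = β * ‖tr x‖ ^ 2 := by ring
    _ ≤ β * (Ctr ^ 2 * (‖val x‖ ^ 2 + G)) := by gcongr; exact norm_tr_sq_le hCtr hx
    _ ≤ β * (Ctr ^ 2 * (CP ^ 2 * G + G)) := by gcongr; exact norm_val_sq_le hCP hx
    _ = constK Ω b Ctr * (1 + CP ^ 2) * G := by rw [constK, ← hβ]; ring

theorem norm_sq_le_of_mem_meanZeroH1 (hCtr : IsTraceConstant Ω Ctr)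
    (hCP : IsPoincareWirtingerConstant Ω CP) {x : GraphSpace Ω} (hx : x ∈ meanZeroH1 Ω) :
    ‖x‖ ^ 2 ≤ (1 + Ctr ^ 2) * (1 + CP ^ 2) * ∑ i, ‖grad i x‖ ^ 2 := by
  set G := ∑ i, ‖grad i x‖ ^ 2
  calc ‖x‖ ^ 2 = ‖val x‖ ^ 2 + (G + ‖tr x‖ ^ 2) := graph_norm_sq x
    _ ≤ ‖val x‖ ^ 2 + (G + Ctr ^ 2 * (‖val x‖ ^ 2 + G)) := by gcongr; exact norm_tr_sq_le hCtr hx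
    _ = (1 + Ctr ^ 2) * (‖val x‖ ^ 2 + G) := by ring
    _ ≤ (1 + Ctr ^ 2) * (CP ^ 2 * G + G) := by gcongr; exact norm_val_sq_le hCP hx
    _ = (1 + Ctr ^ 2) * (1 + CP ^ 2) * G := by ring

/-- The real part of `robinPair`, as a real bilinear form on `𝓗`. -/
def robinForm (h : IsAdmissible Ω a b) : meanZeroH1 Ω →L[ℝ] meanZeroH1 Ω →L[ℝ] ℝ :=
  ContinuousLinearMap.compL ℝ _ _ _ (innerSL ℝ (1 : ℍ[ℝ])) ∘L
    (robinPair h).bilinearComp (meanZeroH1 Ω).subtypeL (meanZeroH1 Ω).subtypeL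

theorem robinForm_apply (h : IsAdmissible Ω a b) (x y : meanZeroH1 Ω) :
    robinForm h x y = (robinPair h x y).re := by
  simp [robinForm, Quaternion.inner_def]

theorem robinForm_self_ge (h : IsAdmissible Ω a b) (hCtr : IsTraceConstant Ω Ctr)
    (hCP : IsPoincareWirtingerConstant Ω CP) (x : meanZeroH1 Ω) :
    (constT Ω a - constT' Ω a * CP - constK Ω b Ctr * (1 + CP ^ 2)) *
      ∑ i, ‖grad i (x : GraphSpace Ω)‖ ^ 2 ≤ robinForm h x x := by
  have hre (f : Fin 3 → ℍ[ℝ]) : (∑ l, f l).re = ∑ l, (f l).re := by simp [Fin.sum_univ_three]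
  simp only [robinForm_apply, robinPair_apply, Quaternion.re_add, hre, re_qpair,
    real_inner_self_eq_norm_sq]
  linarith [constT_mul_le h x, neg_le_inner_lowerTerms h hCP x.2,
    neg_le_inner_boundary h hCtr hCP x.2]

theorem isCoercive_robinForm (h : IsAdmissible Ω a b) (hCtr : IsTraceConstant Ω Ctr)
    (hCP : IsPoincareWirtingerConstant Ω CP)
    (hcond : 0 < constT Ω a - constT' Ω a * CP - constK Ω b Ctr * (1 + CP ^ 2)) :
    IsCoercive (robinForm h) := by
  set κ := constT Ω a - constT' Ω a * CP - constK Ω b Ctr * (1 + CP ^ 2)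
  have hM : 0 < (1 + Ctr ^ 2) * (1 + CP ^ 2) := by positivity
  refine ⟨κ / ((1 + Ctr ^ 2) * (1 + CP ^ 2)), by positivity, fun x => ?_⟩
  refine le_trans ?_ (robinForm_self_ge h hCtr hCP x)
  rw [mul_assoc, ← sq, div_mul_eq_mul_div, div_le_iff₀ hM, mul_assoc, mul_comm (∑ i, _)]
  exact mul_le_mul_of_nonneg_left (norm_sq_le_of_mem_meanZeroH1 hCtr hCP x.2) hcond.le

end Form

section WeakForm

variable {Ω : Set E3} {a : Fin 3 → E3 → ℝ} {b : E3 → ℝ}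

theorem IsMeanZeroH1.congr_ae {u u' : E3 → ℍ[ℝ]} {Du Du' : Fin 3 → E3 → ℍ[ℝ]} {g g' : E3 → ℍ[ℝ]}
    (h : IsMeanZeroH1 Ω u Du g) (hu : u =ᵐ[vol Ω] u') (hDu : ∀ i, Du i =ᵐ[vol Ω] Du' i)
    (hg : g =ᵐ[surf Ω] g') : IsMeanZeroH1 Ω u' Du' g' where
  isH1 :=
    { memLp := h.isH1.memLp.ae_eq hu
      memLp_deriv := fun i => (h.isH1.memLp_deriv i).ae_eq (hDu i)
      weak_deriv := fun i φ hφ => by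
        rw [← integral_congr_ae ((hDu i).mono fun x hx => congrArg (φ x • ·) hx),
          ← integral_congr_ae (hu.mono fun x hx => congrArg (pd i φ x • ·) hx)]
        exact h.isH1.weak_deriv i φ hφ }
  isTrace := by
    obtain ⟨hmem, U, hU, hUu, hUDu, hUg⟩ := h.isTrace
    have hcongr {μ : Measure E3} {w w' : E3 → ℍ[ℝ]} (hw : w =ᵐ[μ] w') (W : E3 → ℍ[ℝ]) :
        eLpNorm (fun x => W x - w x) 2 μ = eLpNorm (fun x => W x - w' x) 2 μ :=
      eLpNorm_congr_ae (hw.mono fun x hx => congrArg (W x - ·) hx)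
    exact ⟨hmem.ae_eq hg, U, hU, hUu.congr fun n => hcongr hu _,
      fun i => (hUDu i).congr fun n => hcongr (hDu i) _, hUg.congr fun n => hcongr hg _⟩
  mean_zero := by rw [← integral_congr_ae hu, h.mean_zero]

theorem formQ_congr_ae {s : ℍ[ℝ]} {u u' v v' g g' k k' : E3 → ℍ[ℝ]}
    {Du Du' Dv Dv' : Fin 3 → E3 → ℍ[ℝ]}
    (hu : u =ᵐ[vol Ω] u') (hDu : ∀ i, Du i =ᵐ[vol Ω] Du' i) (hg : g =ᵐ[surf Ω] g')
    (hv : v =ᵐ[vol Ω] v') (hDv : ∀ i, Dv i =ᵐ[vol Ω] Dv' i) (hk : k =ᵐ[surf Ω] k') :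
    formQ Ω a b s u Du g v Dv k = formQ Ω a b s u' Du' g' v' Dv' k' := by
  have hDuDv l : ∫ x in Ω, star (a l x • Du l x) * (a l x • Dv l x) =
      ∫ x in Ω, star (a l x • Du' l x) * (a l x • Dv' l x) := integral_congr_ae <| by
    filter_upwards [hDu l, hDv l] with x hx hx'
    rw [hx, hx']
  have hDuv l : ∫ x in Ω, star (Du l x) * (pd l (fun y => a l y ^ 2) x • v x) =
      ∫ x in Ω, star (Du' l x) * (pd l (fun y => a l y ^ 2) x • v' x) := integral_congr_ae <| by
    filter_upwards [hDu l, hv] with x hx hx'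
    rw [hx, hx']
  have hvect : ∫ x in Ω, star (vectQ a s Du x) * v x = ∫ x in Ω, star (vectQ a s Du' x) * v' x :=
    integral_congr_ae <| by
      filter_upwards [eventually_all.2 hDu, hv] with x hx hx'
      simp only [vectQ, hx, hx']
  have hbdry : ∫ x, b x • (star (g x) * k x) ∂(surf Ω) =
      ∫ x, b x • (star (g' x) * k' x) ∂(surf Ω) := integral_congr_ae <| by
    filter_upwards [hg, hk] with x hx hx'
    rw [hx, hx']
  have huv : ∫ x in Ω, star (u x) * v x = ∫ x in Ω, star (u' x) * v' x := integral_congr_ae <| by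
    filter_upwards [hu, hv] with x hx hx'
    rw [hx, hx']
  simp only [formQ, hDuDv, hDuv, hvect, hbdry, huv]

theorem pd_sq {f : E3 → ℝ} {x : E3} (hf : DifferentiableAt ℝ f x) (l : Fin 3) :
    pd l (fun y => f y ^ 2) x = 2 * (f x * pd l f x) := by
  simp [pd, (hf.hasFDerivAt.pow 2).fderiv, mul_assoc]

theorem integral_star_smul_mul_smul {α : Type*} [MeasurableSpace α] {μ : Measure α} {m : α → ℝ}
    (hm : MemLp m ∞ μ) (p q : Lp ℍ[ℝ] 2 μ) :
    ∫ z, star (m z • p z) * (m z • q z) ∂μ = qpair μ (mulReal hm p) (mulReal hm q) := by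
  rw [qpair_apply]
  refine integral_congr_ae ?_
  filter_upwards [coeFn_mulReal hm p, coeFn_mulReal hm q] with z hp hq
  rw [hp, hq]

theorem integral_smul_star_mul {α : Type*} [MeasurableSpace α] {μ : Measure α} {m : α → ℝ}
    (hm : MemLp m ∞ μ) (p q : Lp ℍ[ℝ] 2 μ) :
    ∫ z, m z • (star (p z) * q z) ∂μ = qpair μ (mulReal hm p) q := by
  rw [qpair_apply]
  refine integral_congr_ae ?_
  filter_upwards [coeFn_mulReal hm p] with z hz
  rw [hz, Quaternion.star_smul, smul_mul_assoc]

theorem half_integral_star_mul_pd_sq (h : IsAdmissible Ω a b) (l : Fin 3) (p q : V Ω) :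
    (1 / 2 : ℝ) • ∫ z in Ω, star (p z) * (pd l (fun y => a l y ^ 2) z • q z) =
      qpair (vol Ω) (mulReal (h.memLp_mul_pd l l) p) q := by
  rw [← integral_smul_star_mul, ← integral_smul]
  refine integral_congr_ae ?_
  filter_upwards [ae_restrict_mem h.isOpen.measurableSet] with z hz
  have hdiff : DifferentiableAt ℝ (a l) z :=
    ((h.contDiffOn l).differentiableOn one_ne_zero).differentiableAt (h.isOpen.mem_nhds hz)
  rw [pd_sq hdiff, mul_smul_comm, smul_smul]
  congr 1
  ring

theorem coeFn_lowerTerms (h : IsAdmissible Ω a b) (x : GraphSpace Ω) :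
    lowerTerms h x =ᵐ[vol Ω] fun z =>
      ∑ i, ∑ l, lowerUnit i l * ((a l z * pd l (a i) z) • grad i x z) := by
  rw [lowerTerms_apply, ← Fintype.sum_prod_type']
  have hterm (p : Fin 3 × Fin 3) := Lp.coeFn_smul (lowerUnit p.1 p.2)
    (mulReal (h.memLp_mul_pd p.1 p.2) (grad p.1 x))
  filter_upwards [Lp.coeFn_finsetSum Finset.univ fun p : Fin 3 × Fin 3 =>
      lowerUnit p.1 p.2 • mulReal (h.memLp_mul_pd p.1 p.2) (grad p.1 x),
    eventually_all.2 hterm,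
    eventually_all.2 fun p : Fin 3 × Fin 3 =>
      coeFn_mulReal (h.memLp_mul_pd p.1 p.2) (grad p.1 x)] with z hsum hsmul hmul
  rw [hsum, Finset.sum_apply, ← Fintype.sum_prod_type']
  simp only [hsmul, Pi.smul_apply, hmul, smul_eq_mul]

theorem vectQ_add_sum_diag {s : ℍ[ℝ]} (hs : s.re = 0) (D : Fin 3 → E3 → ℍ[ℝ]) (z : E3) :
    vectQ a s D z + ∑ l, (a l z * pd l (a l) z) • D l z =
      ∑ i, ∑ l, lowerUnit i l * ((a l z * pd l (a i) z) • D i z) := by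
  rw [Finset.sum_comm, vectQ, hs, mul_zero, zero_smul, sub_zero, ← Finset.sum_add_distrib]
  refine Finset.sum_congr rfl fun l _ => ?_
  have hdiag : (a l z * pd l (a l) z) • D l z =
      ∑ i, if l = i then (a l z * pd l (a i) z) • D i z else 0 := by simp
  rw [hdiag, ← Finset.sum_add_distrib]
  refine Finset.sum_congr rfl fun i _ => ?_
  by_cases hli : l = i <;> simp [lowerUnit, hli]

theorem integral_star_vectQ_mul (h : IsAdmissible Ω a b) {s : ℍ[ℝ]} (hs : s.re = 0)
    (x : GraphSpace Ω) (q : V Ω) :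
    ∫ z in Ω, star (vectQ a s (fun i => grad i x) z) * q z =
      qpair (vol Ω) (lowerTerms h x) q -
        ∑ l, qpair (vol Ω) (mulReal (h.memLp_mul_pd l l) (grad l x)) q := by
  rw [← sum_apply, ← map_sum, ← sub_apply, ← map_sub, qpair_apply]
  refine integral_congr_ae ?_
  filter_upwards [coeFn_lowerTerms h x, Lp.coeFn_sub (lowerTerms h x)
      (∑ l, mulReal (h.memLp_mul_pd l l) (grad l x)),
    Lp.coeFn_finsetSum Finset.univ fun l => mulReal (h.memLp_mul_pd l l) (grad l x),
    eventually_all.2 fun l => coeFn_mulReal (h.memLp_mul_pd l l) (grad l x)]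
    with z hlow hsub hsum hdiag
  rw [hsub, Pi.sub_apply, hlow, hsum, Finset.sum_apply, ← vectQ_add_sum_diag hs]
  simp only [hdiag, add_sub_cancel_right]

theorem formQ_eq_robinPair_add (h : IsAdmissible Ω a b) {s : ℍ[ℝ]} (hs : s.re = 0)
    (x y : GraphSpace Ω) :
    formQ Ω a b s (val x) (fun i => grad i x) (tr x) (val y) (fun i => grad i y) (tr y) =
      robinPair h x y + ‖s‖ ^ 2 • qpair (vol Ω) (val x) (val y) := by
  simp only [formQ, robinPair_apply, integral_star_smul_mul_smul (h.memLp_coeff _),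
    Finset.smul_sum, half_integral_star_mul_pd_sq h, integral_star_vectQ_mul h hs,
    integral_smul_star_mul h.memLp_boundary, qpair_apply (val x)]
  abel

end WeakForm

/-! ### The resolvent set -/

section Resolvent

variable {Ω : Set E3} {a : Fin 3 → E3 → ℝ} {b : E3 → ℝ}

theorem pseudoRes_eq {s : ℍ[ℝ]} {R : V Ω →L[ℍ[ℝ]ᵐᵒᵖ] V Ω} (hR : IsInverseQ Ω a b s R) :
    pseudoRes Ω a b s = R := by
  have hex : ∃ R, IsInverseQ Ω a b s R := ⟨R, hR⟩
  rw [pseudoRes, dif_pos hex]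
  ext1 F
  exact (hR F _).1 ((hex.choose_spec F _).2 rfl)

variable [IsFiniteMeasure (vol Ω)]

theorem IsMeanZeroH1.exists_mem_ae_eq {u : E3 → ℍ[ℝ]} {Du : Fin 3 → E3 → ℍ[ℝ]} {g : E3 → ℍ[ℝ]}
    (h : IsMeanZeroH1 Ω u Du g) :
    ∃ x ∈ meanZeroH1 Ω, val x =ᵐ[vol Ω] u ∧ (∀ i, grad i x =ᵐ[vol Ω] Du i) ∧
      tr x =ᵐ[surf Ω] g := by
  have hu := h.isH1.memLp.coeFn_toLp
  have hDu i := (h.isH1.memLp_deriv i).coeFn_toLp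
  have hg := h.isTrace.1.coeFn_toLp
  exact ⟨triple (h.isH1.memLp.toLp u) (fun i => (h.isH1.memLp_deriv i).toLp (Du i))
    (h.isTrace.1.toLp g), mem_meanZeroH1.2 (h.congr_ae hu.symm (fun i => (hDu i).symm) hg.symm),
    hu, hDu, hg⟩

/-- The embedding of `𝓗` into `L²(Ω, ℍ)`. -/
def embed (Ω : Set E3) [IsFiniteMeasure (vol Ω)] : meanZeroH1 Ω →L[ℝ] V Ω :=
  val ∘L (meanZeroH1 Ω).subtypeL

theorem re_robinPair_add (h : IsAdmissible Ω a b) (t : ℝ) (x y : meanZeroH1 Ω) :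
    (robinPair h x y + t ^ 2 • qpair (vol Ω) (val x) (val y)).re =
      shiftedForm (robinForm h) (embed Ω) t x y := by
  rw [shiftedForm_apply, robinForm_apply, Quaternion.re_add, Quaternion.re_smul, re_qpair,
    smul_eq_mul]
  rfl

/-- The solution `u ∈ 𝓗`, taken with its weak gradient and its trace, of the weak problem
`Q_s(T) u = F` for `Re s = 0` and `|s| = t`. -/
def weakSolver (h : IsAdmissible Ω a b) (hB : IsCoercive (robinForm h)) (t : ℝ) :
    V Ω →L[ℝ] meanZeroH1 Ω :=
  varSolver hB (embed Ω) t

/- Only real parts enter the variational equation; the quaternionic equation follows since `𝓗` is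
stable under right multiplication of the test function by quaternions. -/
theorem eq_weakSolver_iff (h : IsAdmissible Ω a b) (hB : IsCoercive (robinForm h)) (t : ℝ)
    (F : V Ω) (x : meanZeroH1 Ω) :
    x = weakSolver h hB t F ↔ ∀ y ∈ meanZeroH1 Ω,
      robinPair h x y + t ^ 2 • qpair (vol Ω) (val x) (val y) = qpair (vol Ω) F (val y) := by
  rw [weakSolver, eq_varSolver_iff]
  constructor
  · refine fun hx y hy => eq_of_re_mul_eq fun c => ?_
    have hxc := hx ⟨MulOpposite.op c • y, op_smul_mem_meanZeroH1 c hy⟩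
    rw [← re_robinPair_add, robinPair_op_smul_right, val_op_smul, qpair_op_smul_right,
      ← smul_mul_assoc, ← add_mul] at hxc
    rw [hxc, ← qpair_op_smul_right, re_qpair]
    rfl
  · intro hx y
    rw [← re_robinPair_add, hx y y.2, re_qpair]
    rfl

theorem val_weakSolver_op_smul (h : IsAdmissible Ω a b) (hB : IsCoercive (robinForm h)) (t : ℝ)
    (c : ℍ[ℝ]) (F : V Ω) :
    val (weakSolver h hB t (MulOpposite.op c • F) : GraphSpace Ω) =
      MulOpposite.op c • val (weakSolver h hB t F : GraphSpace Ω) := by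
  set x := weakSolver h hB t F with hx
  have hcx : ⟨MulOpposite.op c • x, op_smul_mem_meanZeroH1 c x.2⟩ =
      weakSolver h hB t (MulOpposite.op c • F) := by
    refine (eq_weakSolver_iff h hB t _ _).2 fun y hy => ?_
    rw [robinPair_op_smul_left, val_op_smul, qpair_op_smul_left, qpair_op_smul_left,
      ← (eq_weakSolver_iff h hB t F x).1 hx y hy, mul_add, mul_smul_comm]
  rw [← hcx]
  rfl

theorem isWeakSol_iff (h : IsAdmissible Ω a b) (hB : IsCoercive (robinForm h)) {s : ℍ[ℝ]}
    (hs : s.re = 0) (F u : V Ω) :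
    IsWeakSol Ω a b s F u ↔ u = val (weakSolver h hB ‖s‖ F : GraphSpace Ω) := by
  constructor
  · rintro ⟨Du, g, hu, hsol⟩
    obtain ⟨x, hx, hxu, hxDu, hxg⟩ := hu.exists_mem_ae_eq
    suffices hsolver : ⟨x, hx⟩ = weakSolver h hB ‖s‖ F by rw [← hsolver, Lp.ext hxu]
    refine (eq_weakSolver_iff h hB _ F ⟨x, hx⟩).2 fun y hy => ?_
    rw [← formQ_eq_robinPair_add h hs, qpair_apply, ← hsol _ _ _ (mem_meanZeroH1.1 hy)]
    exact formQ_congr_ae hxu hxDu hxg .rfl (fun _ => .rfl) .rfl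
  · rintro rfl
    set x := weakSolver h hB ‖s‖ F with hx
    refine ⟨fun i => grad i (x : GraphSpace Ω), tr (x : GraphSpace Ω), mem_meanZeroH1.1 x.2,
      fun v Dv k hv => ?_⟩
    obtain ⟨y, hy, hyv, hyDv, hyk⟩ := hv.exists_mem_ae_eq
    rw [← formQ_congr_ae .rfl (fun _ => .rfl) .rfl hyv hyDv hyk, formQ_eq_robinPair_add h hs,
      (eq_weakSolver_iff h hB _ F x).1 hx y hy, qpair_apply]
    exact integral_congr_ae (hyv.mono fun z hz => congrArg (star (F z) * ·) hz)

/-- The inverse of `Q_s(T)` for `Re s = 0` and `|s| = t`. -/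
def weakResolvent (h : IsAdmissible Ω a b) (hB : IsCoercive (robinForm h)) (t : ℝ) :
    V Ω →L[ℍ[ℝ]ᵐᵒᵖ] V Ω where
  toFun F := val (weakSolver h hB t F : GraphSpace Ω)
  map_add' F G := by simp only [map_add, Submodule.coe_add]
  map_smul' c F := val_weakSolver_op_smul h hB t c.unop F
  cont := by fun_prop

theorem isInverseQ_weakResolvent (h : IsAdmissible Ω a b) (hB : IsCoercive (robinForm h))
    {s : ℍ[ℝ]} (hs : s.re = 0) : IsInverseQ Ω a b s (weakResolvent h hB ‖s‖) :=
  isWeakSol_iff h hB hs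

theorem pseudoRes_apply (h : IsAdmissible Ω a b) (hB : IsCoercive (robinForm h)) {s : ℍ[ℝ]}
    (hs : s.re = 0) (F : V Ω) :
    pseudoRes Ω a b s F = val (weakSolver h hB ‖s‖ F : GraphSpace Ω) := by
  rw [pseudoRes_eq (isInverseQ_weakResolvent h hB hs)]
  rfl

end Resolvent

section VecOp

variable {Ω : Set E3} {a : Fin 3 → E3 → ℝ} {b : E3 → ℝ}

/-- The operator `T` in terms of the weak gradient. -/
def vecOp (h : IsAdmissible Ω a b) : GraphSpace Ω →L[ℝ] V Ω :=
  ∑ l, e l • (mulReal (h.memLp_coeff l) ∘L grad l)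

theorem coeFn_vecOp (h : IsAdmissible Ω a b) (x : GraphSpace Ω) :
    vecOp h x =ᵐ[vol Ω] fun z => ∑ l, e l * (a l z • grad l x z) := by
  rw [vecOp, sum_apply]
  filter_upwards [Lp.coeFn_finsetSum Finset.univ fun l =>
      (e l • (mulReal (h.memLp_coeff l) ∘L grad l)) x,
    eventually_all.2 fun l => Lp.coeFn_smul (e l) (mulReal (h.memLp_coeff l) (grad l x)),
    eventually_all.2 fun l => coeFn_mulReal (h.memLp_coeff l) (grad l x)] with z hsum hsmul hmul
  rw [hsum, Finset.sum_apply]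
  simp only [smul_apply, ContinuousLinearMap.comp_apply, hsmul, Pi.smul_apply, hmul, smul_eq_mul]

theorem IsTest.mul_left (hΩ : IsOpen Ω) {f φ : E3 → ℝ} (hf : ContDiffOn ℝ 1 f Ω)
    (hφ : IsTest Ω φ) : IsTest Ω (fun x => f x * φ x) where
  contDiff := contDiff_iff_contDiffAt.2 fun x => by
    by_cases hx : x ∈ tsupport φ
    · exact (hf.contDiffAt (hΩ.mem_nhds (hφ.tsupport_subset hx))).mul hφ.contDiff.contDiffAt
    · refine contDiffAt_const (c := 0) |>.congr_of_eventuallyEq ?_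
      filter_upwards [notMem_tsupport_iff_eventuallyEq.1 hx] with y hy
      rw [hy, Pi.zero_apply, mul_zero]
  hasCompactSupport := hφ.hasCompactSupport.mul_left
  tsupport_subset := (closure_mono (Function.support_mul_subset_right f φ)).trans hφ.tsupport_subset

theorem IsVecOp.unique (hΩ : IsOpen Ω) {v w w' : V Ω} (h : IsVecOp Ω a v w)
    (h' : IsVecOp Ω a v w') : w = w' := by
  have hlocal : LocallyIntegrableOn (w - w' : V Ω) Ω :=
    locallyIntegrableOn_of_locallyIntegrable_restrict
      ((Lp.memLp (w - w')).locallyIntegrable one_le_two)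
  have hzero : ∀ᵐ x, x ∈ Ω → (w - w' : V Ω) x = 0 :=
    hΩ.ae_eq_zero_of_integral_contDiff_smul_eq_zero hlocal fun φ hφ hc hs => by
      have hT : IsTest Ω φ := ⟨hφ.of_le (by exact_mod_cast le_top), hc, hs⟩
      have hsupp : Function.support (fun x => φ x • (w - w' : V Ω) x) ⊆ Ω := fun x hx =>
        hs (subset_tsupport φ (Function.support_smul_subset_left _ _ hx))
      rw [← setIntegral_eq_integral_of_forall_compl_eq_zero fun x hx =>
          Function.notMem_support.1 fun h => hx (hsupp h),
        ← testInt_apply hT.memLp, map_sub, testInt_apply, testInt_apply, h φ hT, h' φ hT, sub_self]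
  exact sub_eq_zero.1 (Lp.eq_zero_iff_ae_eq_zero.2
    ((ae_restrict_iff' hΩ.measurableSet).2 hzero))

variable [IsFiniteMeasure (vol Ω)]

theorem isVecOp_val (h : IsAdmissible Ω a b) {x : GraphSpace Ω} (hx : x ∈ meanZeroH1 Ω) :
    IsVecOp Ω a (val x) (vecOp h x) := by
  intro φ hφ
  have hH1 := (mem_meanZeroH1.1 hx).isH1
  have hψ l := hφ.mul_left h.isOpen (h.contDiffOn l)
  have hval l : Integrable (fun z => pd l (fun y => a l y * φ y) z • val x z) (vol Ω) :=
    memLp_one_iff_integrable.1 (hH1.memLp.smul ((hψ l).memLp_pd l))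
  have hgrad l : Integrable (fun z => (a l z * φ z) • grad l x z) (vol Ω) :=
    memLp_one_iff_integrable.1 ((hH1.memLp_deriv l).smul (hψ l).memLp)
  calc ∫ z in Ω, φ z • vecOp h x z
      = ∫ z in Ω, ∑ l, e l * ((a l z * φ z) • grad l x z) := by
        refine integral_congr_ae ?_
        filter_upwards [coeFn_vecOp h x] with z hz
        simp only [hz, Finset.smul_sum, mul_smul_comm, smul_smul, mul_comm (φ z)]
    _ = ∑ l, e l * ∫ z in Ω, (a l z * φ z) • grad l x z := by
        rw [integral_finsetSum _ fun l _ => (hgrad l).const_mul (e l)]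
        simp only [integral_const_mul_of_integrable (hgrad _)]
    _ = -∑ l, e l * ∫ z in Ω, pd l (fun y => a l y * φ y) z • val x z := by
        simp only [hH1.weak_deriv _ _ (hψ _), mul_neg, Finset.sum_neg_distrib]
    _ = -∑ l, ∫ z in Ω, pd l (fun y => a l y * φ y) z • (e l * val x z) := by
        simp only [← integral_const_mul_of_integrable (hval _), mul_smul_comm]

theorem opT_val (h : IsAdmissible Ω a b) {x : GraphSpace Ω} (hx : x ∈ meanZeroH1 Ω) :
    opT Ω a (val x) = vecOp h x := by
  have hex : ∃ w, IsVecOp Ω a (val x) w := ⟨_, isVecOp_val h hx⟩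
  rw [opT, dif_pos hex]
  exact hex.choose_spec.unique h.isOpen (isVecOp_val h hx)

end VecOp

/-! ### The `S`-resolvent operators -/

section SResolvent

variable {Ω : Set E3} {a : Fin 3 → E3 → ℝ} {b : E3 → ℝ} [IsFiniteMeasure (vol Ω)]

theorem pseudoRes_mem_domT (h : IsAdmissible Ω a b) (hB : IsCoercive (robinForm h)) {s : ℍ[ℝ]}
    (hs : s.re = 0) (F : V Ω) : pseudoRes Ω a b s F ∈ domT Ω a := by
  rw [pseudoRes_apply h hB hs]
  exact ⟨_, isVecOp_val h (weakSolver h hB ‖s‖ F).2⟩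

theorem leftSRes_apply (h : IsAdmissible Ω a b) (hB : IsCoercive (robinForm h)) {s : ℍ[ℝ]}
    (hs : s.re = 0) (F : V Ω) :
    leftSRes Ω a b s F =
      embed Ω (weakSolver h hB ‖s‖ (star s • F)) - vecOp h (weakSolver h hB ‖s‖ F) := by
  rw [leftSRes, pseudoRes_apply h hB hs, pseudoRes_apply h hB hs,
    opT_val h (weakSolver h hB ‖s‖ F).2]
  rfl

theorem rightSRes_apply (h : IsAdmissible Ω a b) (hB : IsCoercive (robinForm h)) {s : ℍ[ℝ]}
    (hs : s.re = 0) (F : V Ω) :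
    rightSRes Ω a b s F =
      star s • embed Ω (weakSolver h hB ‖s‖ F) - vecOp h (weakSolver h hB ‖s‖ F) := by
  rw [rightSRes, pseudoRes_apply h hB hs, opT_val h (weakSolver h hB ‖s‖ F).2, neg_sub]
  rfl

theorem exists_norm_vecOp_weakSolver_le (h : IsAdmissible Ω a b) (hB : IsCoercive (robinForm h)) :
    ∃ Θ, ∀ (s : ℍ[ℝ]) (F : V Ω),
      (1 + ‖s‖) * ‖vecOp h (weakSolver h hB ‖s‖ F)‖ ≤ Θ * ‖F‖ := by
  obtain ⟨δ, hδ, hBδ⟩ := hB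
  refine ⟨‖vecOp h‖ * (δ⁻¹ * ‖embed Ω‖ + (√δ)⁻¹), fun s F => ?_⟩
  set x := weakSolver h ⟨δ, hδ, hBδ⟩ ‖s‖ F
  calc (1 + ‖s‖) * ‖vecOp h x‖ ≤ (1 + ‖s‖) * (‖vecOp h‖ * ‖x‖) := by
        gcongr
        exact (vecOp h).le_opNorm x
    _ = ‖vecOp h‖ * ((1 + |‖s‖|) * ‖x‖) := by rw [abs_norm]; ring
    _ ≤ ‖vecOp h‖ * ((δ⁻¹ * ‖embed Ω‖ + (√δ)⁻¹) * ‖F‖) := by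
        gcongr ‖vecOp h‖ * ?_
        exact one_add_abs_mul_norm_varSolver_le ⟨δ, hδ, hBδ⟩ (embed Ω)
          ‖s‖ F hδ hBδ
    _ = _ := by ring

theorem exists_norm_embed_weakSolver_le (h : IsAdmissible Ω a b)
    (hB : IsCoercive (robinForm h)) :
    ∃ Θ, 0 ≤ Θ ∧ ∀ (s : ℍ[ℝ]) (F : V Ω),
      ‖s‖ * (1 + ‖s‖) * ‖embed Ω (weakSolver h hB ‖s‖ F)‖ ≤ Θ * ‖F‖ := by
  obtain ⟨δ, hδ, hBδ⟩ := hB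
  refine ⟨‖embed Ω‖ * (√δ)⁻¹ + 1, by positivity, fun s F => ?_⟩
  simpa only [weakSolver, abs_norm] using
    abs_mul_one_add_abs_mul_norm_le ⟨δ, hδ, hBδ⟩ (embed Ω) ‖s‖ F
      hδ hBδ

theorem exists_norm_leftSRes_le (h : IsAdmissible Ω a b) (hB : IsCoercive (robinForm h)) :
    ∃ Θ, ∀ s : ℍ[ℝ], s.re = 0 → s ≠ 0 → ∀ F, (1 + ‖s‖) * ‖leftSRes Ω a b s F‖ ≤ Θ * ‖F‖ := by
  obtain ⟨Θ, hΘ0, hΘ⟩ := exists_norm_embed_weakSolver_le h hB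
  obtain ⟨Θ', hΘ'⟩ := exists_norm_vecOp_weakSolver_le h hB
  refine ⟨Θ + Θ', fun s hs hs0 F => ?_⟩
  set u := embed Ω (weakSolver h hB ‖s‖ (star s • F))
  have hu : (1 + ‖s‖) * ‖u‖ ≤ Θ * ‖F‖ := by
    refine le_of_mul_le_mul_left ?_ (norm_pos_iff.2 hs0)
    calc ‖s‖ * ((1 + ‖s‖) * ‖u‖) ≤ Θ * ‖star s • F‖ := by
          simpa only [mul_assoc] using hΘ s (star s • F)
      _ ≤ Θ * (‖s‖ * ‖F‖) := by
          gcongr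
          simpa only [norm_star] using norm_smul_le (star s) F
      _ = ‖s‖ * (Θ * ‖F‖) := by ring
  rw [leftSRes_apply h hB hs]
  calc (1 + ‖s‖) * ‖u - vecOp h (weakSolver h hB ‖s‖ F)‖
      ≤ (1 + ‖s‖) * (‖u‖ + ‖vecOp h (weakSolver h hB ‖s‖ F)‖) := by
        gcongr
        exact norm_sub_le _ _
    _ ≤ (Θ + Θ') * ‖F‖ := by linarith [hΘ' s F]

theorem exists_norm_rightSRes_le (h : IsAdmissible Ω a b) (hB : IsCoercive (robinForm h)) :
    ∃ Θ, ∀ s : ℍ[ℝ], s.re = 0 → ∀ F, (1 + ‖s‖) * ‖rightSRes Ω a b s F‖ ≤ Θ * ‖F‖ := by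
  obtain ⟨Θ, -, hΘ⟩ := exists_norm_embed_weakSolver_le h hB
  obtain ⟨Θ', hΘ'⟩ := exists_norm_vecOp_weakSolver_le h hB
  refine ⟨Θ + Θ', fun s hs F => ?_⟩
  set x := weakSolver h hB ‖s‖ F
  rw [rightSRes_apply h hB hs]
  calc (1 + ‖s‖) * ‖star s • embed Ω x - vecOp h x‖
      ≤ (1 + ‖s‖) * (‖s‖ * ‖embed Ω x‖ + ‖vecOp h x‖) := by
        gcongr
        refine norm_sub_le_of_le ?_ le_rfl
        simpa only [norm_star] using norm_smul_le (star s) (embed Ω x)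
    _ ≤ (Θ + Θ') * ‖F‖ := by linarith [hΘ s F, hΘ' s F]

end SResolvent

section Integrands

variable {Ω : Set E3} {a : Fin 3 → E3 → ℝ} {b : E3 → ℝ} [IsFiniteMeasure (vol Ω)]
  {s : ℝ → ℍ[ℝ]} {F : ℝ → V Ω} {S : Set ℝ}

theorem continuousOn_weakSolver (h : IsAdmissible Ω a b) (hB : IsCoercive (robinForm h))
    (hs : ContinuousOn s S) (hF : ContinuousOn F S) :
    ContinuousOn (fun t => weakSolver h hB ‖s t‖ (F t)) S :=
  ((continuous_varSolver hB (embed Ω)).comp_continuousOn hs.norm).clm_apply hF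

theorem continuousOn_leftSRes (h : IsAdmissible Ω a b) (hB : IsCoercive (robinForm h))
    (hre : ∀ t, (s t).re = 0) (hs : ContinuousOn s S) (hF : ContinuousOn F S) :
    ContinuousOn (fun t => leftSRes Ω a b (s t) (F t)) S := by
  simp only [leftSRes_apply h hB (hre _)]
  have hstar := starCLM.continuous.comp_continuousOn hs
  exact ((embed Ω).continuous.comp_continuousOn
      (continuousOn_weakSolver h hB hs (hstar.smul hF))).sub
    (((vecOp h).comp (meanZeroH1 Ω).subtypeL).continuous.comp_continuousOn
      (continuousOn_weakSolver h hB hs hF))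

theorem continuousOn_rightSRes (h : IsAdmissible Ω a b) (hB : IsCoercive (robinForm h))
    (hre : ∀ t, (s t).re = 0) (hs : ContinuousOn s S) (hF : ContinuousOn F S) :
    ContinuousOn (fun t => rightSRes Ω a b (s t) (F t)) S := by
  simp only [rightSRes_apply h hB (hre _)]
  have hstar := starCLM.continuous.comp_continuousOn hs
  have hx := continuousOn_weakSolver h hB hs hF
  exact (hstar.smul ((embed Ω).continuous.comp_continuousOn hx)).sub
    (((vecOp h).comp (meanZeroH1 Ω).subtypeL).continuous.comp_continuousOn hx)

variable {I : ℍ[ℝ]} {α : ℝ}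

theorem norm_neg_mul_inv (hI1 : ‖I‖ = 1) : ‖-I * I⁻¹‖ = 1 := by
  rw [norm_mul, norm_neg, norm_inv, hI1, inv_one, mul_one]

theorem integrable_integrandL (h : IsAdmissible Ω a b) (hB : IsCoercive (robinForm h))
    (hI : I.re = 0) (hI1 : ‖I‖ = 1) (hα : 0 < α) (hα1 : α < 1) (v : V Ω) :
    Integrable (integrandL Ω a b I α v) := by
  obtain ⟨Θ, hΘ⟩ := exists_norm_leftSRes_le h hB
  have hre (t : ℝ) : (-(t • I)).re = 0 := by simp [hI]
  have hcont : ContinuousOn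
      (fun t : ℝ => (-I * I⁻¹ * qpow (-(t • I)) (α - 1)) • opT Ω a v) {0}ᶜ :=
    (continuousOn_const.mul (continuousOn_qpow_neg_smul hI hI1 _)).smul continuousOn_const
  refine Integrable.smul (2 * Real.pi)⁻¹
    (integrable_of_norm_le_abs_rpow_div (M := |Θ| * (2 * ‖opT Ω a v‖)) hα hα1
      (continuousOn_leftSRes h hB hre (by fun_prop) hcont) fun t ht => ?_)
  set F := (-I * I⁻¹ * qpow (-(t • I)) (α - 1)) • opT Ω a v
  have hF : ‖F‖ ≤ 2 * |t| ^ (α - 1) * ‖opT Ω a v‖ := by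
    refine (norm_smul_le _ _).trans ?_
    rw [norm_mul, norm_neg_mul_inv hI1, one_mul, ← norm_neg_smul_unit hI1 t]
    gcongr
    exact norm_qpow_le _ _
  have hs0 : -(t • I) ≠ 0 := by rwa [← norm_pos_iff, norm_neg_smul_unit hI1, abs_pos]
  rw [← mul_div_assoc, le_div_iff₀' (by positivity)]
  calc (1 + |t|) * ‖leftSRes Ω a b (-(t • I)) F‖ ≤ Θ * ‖F‖ := by
        simpa only [norm_neg_smul_unit hI1] using hΘ _ (hre t) hs0 F
    _ ≤ |Θ| * (2 * |t| ^ (α - 1) * ‖opT Ω a v‖) := by gcongr; exact le_abs_self Θ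
    _ = |Θ| * (2 * ‖opT Ω a v‖) * |t| ^ (α - 1) := by ring

theorem integrable_integrandR (h : IsAdmissible Ω a b) (hB : IsCoercive (robinForm h))
    (hI : I.re = 0) (hI1 : ‖I‖ = 1) (hα : 0 < α) (hα1 : α < 1) (v : V Ω) :
    Integrable (integrandR Ω a b I α v) := by
  obtain ⟨Θ, hΘ⟩ := exists_norm_rightSRes_le h hB
  have hre (t : ℝ) : (-(t • I)).re = 0 := by simp [hI]
  have hcont : ContinuousOn (fun t : ℝ => qpow (-(t • I)) (α - 1) * (-I * I⁻¹)) {0}ᶜ :=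
    (continuousOn_qpow_neg_smul hI hI1 _).mul continuousOn_const
  refine Integrable.smul (2 * Real.pi)⁻¹
    (integrable_of_norm_le_abs_rpow_div (M := 2 * (Θ * ‖opT Ω a v‖)) hα hα1
      (hcont.smul (continuousOn_rightSRes h hB hre (by fun_prop) continuousOn_const))
      fun t ht => ?_)
  set w := rightSRes Ω a b (-(t • I)) (opT Ω a v)
  have hc : ‖qpow (-(t • I)) (α - 1) * (-I * I⁻¹)‖ ≤ 2 * |t| ^ (α - 1) := by
    rw [norm_mul, norm_neg_mul_inv hI1, mul_one, ← norm_neg_smul_unit hI1 t]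
    exact norm_qpow_le _ _
  rw [← mul_div_assoc, le_div_iff₀' (by positivity)]
  calc (1 + |t|) * ‖(qpow (-(t • I)) (α - 1) * (-I * I⁻¹)) • w‖
      ≤ (1 + |t|) * (2 * |t| ^ (α - 1) * ‖w‖) := by
        gcongr
        exact (norm_smul_le _ _).trans (by gcongr)
    _ = 2 * |t| ^ (α - 1) * ((1 + |t|) * ‖w‖) := by ring
    _ ≤ 2 * |t| ^ (α - 1) * (Θ * ‖opT Ω a v‖) := by
        gcongr ?_ * ?_
        simpa only [norm_neg_smul_unit hI1] using hΘ _ (hre t) (opT Ω a v)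
    _ = 2 * (Θ * ‖opT Ω a v‖) * |t| ^ (α - 1) := by ring

end Integrands

end RobinFractional

end

open RobinFractional in
theorem theorem5p6_general (Ω : Set E3) [IsFiniteMeasure (vol Ω)] (b : E3 → ℝ)
    (a : Fin 3 → E3 → ℝ) (h : IsAdmissible Ω a b)
    (Ctr CP : ℝ) (hCtr : IsTraceConstant Ω Ctr) (hCP : IsPoincareWirtingerConstant Ω CP)
    (hcond : 0 < constT Ω a - constT' Ω a * CP - constK Ω b Ctr * (1 + CP ^ 2)) :
    (∀ s : ℍ[ℝ], s.re = 0 →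
      s ∈ sResolventSet Ω a b ∧ ∀ F : V Ω, pseudoRes Ω a b s F ∈ domT Ω a) ∧
    (∀ I : ℍ[ℝ], I.re = 0 → ‖I‖ = 1 → ∀ α : ℝ, 0 < α → α < 1 → ∀ v ∈ domT Ω a,
      Integrable (integrandL Ω a b I α v) ∧ Integrable (integrandR Ω a b I α v)) := by
  have hB : IsCoercive (robinForm h) := isCoercive_robinForm h hCtr hCP hcond
  refine ⟨fun s hs => ⟨⟨_, isInverseQ_weakResolvent h hB hs⟩, pseudoRes_mem_domT h hB hs⟩, ?_⟩
  intro I hI hI1 α hα hα1 v _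
  exact ⟨integrable_integrandL h hB hI hI1 hα hα1 v, integrable_integrandR h hB hI hI1 hα hα1 v⟩

open RobinFractional in
theorem theorem5p6 (Ω : Set E3) (hΩ : IsBoundedC1Domain Ω)
    (b : E3 → ℝ) (hb : ContinuousOn b (frontier Ω))
    (a : Fin 3 → E3 → ℝ) (ha : ∀ l, IsC1Closure Ω (a l))
    (Ctr CP : ℝ) (hCtr : IsTraceConstant Ω Ctr) (hCP : IsPoincareWirtingerConstant Ω CP)
    (hcond : 0 < constT Ω a - constT' Ω a * CP - constK Ω b Ctr * (1 + CP ^ 2))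
    (hCT : 0 < constT Ω a) :
    (∀ s : ℍ[ℝ], s.re = 0 → s ≠ 0 →
      s ∈ sResolventSet Ω a b ∧ ∀ F : V Ω, pseudoRes Ω a b s F ∈ domT Ω a) ∧
    (∀ I : ℍ[ℝ], I.re = 0 → ‖I‖ = 1 → ∀ α : ℝ, 0 < α → α < 1 → ∀ v ∈ domT Ω a,
      Integrable (integrandL Ω a b I α v) ∧ Integrable (integrandR Ω a b I α v)) := by
  have := hΩ.isFiniteMeasure
  obtain ⟨hres, hint⟩ :=
    theorem5p6_general Ω b a (hΩ.isAdmissible hb ha) Ctr CP hCtr hCP hcond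
  exact ⟨fun s hs _ => hres s hs, hint⟩
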